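/- **Linear tensor regression with a nonconvex low-tubal-rank penalty.** *Tensors.* For $\mathcal T\in\mathbb R^{d\times d\times d_3}$ let $\sigma_{1j}(\mathcal T)\ge\dots\ge\sigma_{dj}(\mathcal T)$ be the singular values of the $j$-th frontal slice of the (unnormalised) discrete Fourier transform of $\mathcal T$ along the third dimension, i.e. the diagonal entries of the t-SVD of $\mathcal T$ in the Fourier domain. Put ${\rm rank}_t(\mathcal T)=\#\{i:\exists j,\ \sigma_{ij}(\mathcal T)\neq0\}$, $\|\mathcal T\|_*=\frac1{d_3}\sum_{i,j}\sigma_{ij}(\mathcal T)$ and, for a univariate penalty $\rho_\lambda$, $\rho_\lambda(\mathcal T)=\frac1{d_3}\sum_{i,j}\rho_\lambda(\sigma_{ij}(\mathcal T))$. $\langle\cdot,\cdot\rangle$ and $\|\cdot\|_F$ are the entrywise inner product and the Frobenius norm. *Model.* $y_i=\langle\mathcal X_i,\mathcal B^0\rangle+\epsilon_i$, $i=1,\dots,n$ $(n\ge 1)$, where the pairs $(\mathcal X_i,\epsilon_i)$ are i.i.d., $\epsilon_i$ is independent of $\mathcal X_i$, $\epsilon_i\sim N(0,\sigma^2)$,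 $r={\rm rank}_t(\mathcal B^0)\ge1$, and $\mathcal X_i$ is $\nu$-sub-Gaussian: $\mathbb E\exp(\langle\mathcal X_i,\mathcal U\rangle^2/(2\nu^2))\le2$ for all $\|\mathcal U\|_F=1$. Let $L_n(\mathcal B)=\frac1{2n}\sum_i(y_i-\langle\mathcal X_i,\mathcal B\rangle)^2$ and $\mathbf H=\mathbb E\big[\frac1n\sum_i{\rm vec}(\mathcal X_i){\rm vec}(\mathcal X_i)^{\mathsf T}\big]$, with smallest eigenvalue $\Lambda_{\min}(\mathbf H)\ge\kappa>0$. *Penalty.* $\rho_\lambda:\mathbb R\to\mathbb R$ is continuous, even, $\rho_\lambda(0)=0$, concave and nondecreasing on $[0,\infty)$, $\rho_\lambda(x)/x$ is nonincreasing on $(0,\infty)$, $\rho_\lambda$ is differentiable off $0$ with $\lim_{t\to0^+}\rho_\lambda'(t)=\lambda C_{\rho'}$, $C_{\rho'}>0$, and $\rho_\lambda(x)+\frac\mu2x^2$ is convex for some $\mu>0$ with $3\mu<2\Lambda_{\min}(\mathbf H)$. *Claim.* There are absolute constants $C,c>0$; for all $\nu,\kappa,C_{\rho'}>0$, $\sigma\ge0$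 a constant $C_1>0$ depending only on these; and for every radius $\beta>0$ and every $A>0$ a constant $c_0>0$ depending only on $\nu,\kappa,C_{\rho'},\sigma,\beta,A$, such that the following holds. If $\lambda\ge c_0\sqrt{dd_3/n}$ (in particular if $\lambda\asymp\sqrt{dd_3/n}$ with lower constant at least $c_0$) and $n\ge C_1\,r\,d\,d_3/\beta^2$, then with probability at least $1-d_3e^{-Ad}$, every stationary point $\widehat{\mathcal B}$ of $L_n+\rho_\lambda$ (that is, $0\in\partial(L_n+\rho_\lambda)(\widehat{\mathcal B})$) with $\|\widehat{\mathcal B}-\mathcal B^0\|_F\le\beta$ satisfies $$\|\widehat{\mathcal B}-\mathcal B^0\|_F\le C\frac{C_{\rho'}\lambda\sqrt r}{2\Lambda_{\min}(\mathbf H)-3\mu},\qquad \|\widehat{\mathcal B}-\mathcal B^0\|_*\le C\frac{C_{\rho'}\lambda r}{2\Lambda_{\min}(\mathbf H)-3\mu},$$ $$\frac1n\sum_{i=1}^n\langle\mathcal X_i,\widehat{\mathcal B}-\mathcal B^0\rangle^2\le C_{\rho'}^2\lambda^2r\Big(\frac{c}{2\Lambda_{\min}(\mathbf H)-3\mu}+\frac{c\mu}{(2\Lambda_{\min}(\mathbf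 H)-3\mu)^2}\Big).$$ -/

import Mathlib

open MeasureTheory ProbabilityTheory Filter Topology
open scoped BigOperators NNReal ENNReal RealInnerProductSpace

noncomputable section

/-- Real third-order tensors of size `d × d × d₃`. The inner product is the entrywise one
and the norm is the Frobenius norm. -/
abbrev Tensor (d d₃ : ℕ) : Type := EuclideanSpace ℝ (Fin d × Fin d × Fin d₃)

namespace Tensor

variable {d d₃ : ℕ}

/-- The `j`-th frontal slice of the (unnormalised) discrete Fourier transform of `T` along the
third dimension. -/
def fourierSlice (T : Tensor d d₃) (j : Fin d₃) : Matrix (Fin d) (Fin d) ℂ :=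
  Matrix.of fun a b =>
    ∑ k : Fin d₃,
      Complex.exp (-(2 * (Real.pi : ℂ) * Complex.I * (j : ℕ) * (k : ℕ) / (d₃ : ℂ))) *
        ((T (a, b, k) : ℝ) : ℂ)

/-- The singular value `σ_{ij}` of `T` in the Fourier domain, that is, the `i`-th largest singular
value of the `j`-th Fourier slice. It is the entry `(i, i, j)` of the transformed f-diagonal factor
of the t-SVD of `T`, which is computed slice by slice. -/
def sv (T : Tensor d d₃) (i : Fin d) (j : Fin d₃) : ℝ :=
  (Matrix.toEuclideanLin (T.fourierSlice j)).singularValues (i : ℕ)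

/-- The tubal rank: the number of nonzero singular tubes of the t-SVD. (A tube vanishes iff its
Fourier transform does.) -/
def tubalRank (T : Tensor d d₃) : ℕ := Set.ncard {i : Fin d | ∃ j : Fin d₃, T.sv i j ≠ 0}

/-- The tensor tubal nuclear norm. -/
def nuclearNorm (T : Tensor d d₃) : ℝ := (1 / (d₃ : ℝ)) * ∑ i : Fin d, ∑ j : Fin d₃, T.sv i j

/-- The spectral regularizer induced by a univariate penalty `ρ`. -/
def regularizer (ρ : ℝ → ℝ) (T : Tensor d d₃) : ℝ :=
  (1 / (d₃ : ℝ)) * ∑ i : Fin d, ∑ j : Fin d₃, ρ (T.sv i j)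

end Tensor

/-- `ρ` is an admissible univariate penalty with tuning parameter `lam`, weak convexity
modulus `μ`, and slope `lam * Cρ` at `0⁺`. -/
structure IsPenalty (ρ : ℝ → ℝ) (lam μ Cρ : ℝ) : Prop where
  continuous : Continuous ρ
  concaveOn : ConcaveOn ℝ (Set.Ici 0) ρ
  even : ∀ x, ρ (-x) = ρ x
  map_zero : ρ 0 = 0
  monotoneOn : MonotoneOn ρ (Set.Ici 0)
  antitoneOn_div : AntitoneOn (fun x => ρ x / x) (Set.Ioi 0)
  differentiableAt : ∀ x, x ≠ 0 → DifferentiableAt ℝ ρ x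
  tendsto_deriv : Tendsto (deriv ρ) (𝓝[>] 0) (𝓝 (lam * Cρ))
  mu_pos : 0 < μ
  weaklyConvex : ConvexOn ℝ Set.univ (fun x => ρ x + μ / 2 * x ^ 2)

/-- `g` is a regular (Fréchet) subgradient of `F` at `x`:
`liminf_{y → x} (F y - F x - ⟪g, y - x⟫) / ‖y - x‖ ≥ 0`. -/
def IsRegularSubgradient {E : Type*} [NormedAddCommGroup E] [InnerProductSpace ℝ E]
    (F : E → ℝ) (x g : E) : Prop :=
  ∀ η : ℝ, 0 < η → ∀ᶠ y in 𝓝 x, F x + ⟪g, y - x⟫ - η * ‖y - x‖ ≤ F y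

/-- `x` is a stationary point of `F`: `0 ∈ ∂F(x)`. For functions that become convex after adding
a multiple of `‖·‖²`, as the objectives below do, the regular, limiting and
Clarke subdifferentials coincide. -/
def IsStationaryPoint {E : Type*} [NormedAddCommGroup E] [InnerProductSpace ℝ E]
    (F : E → ℝ) (x : E) : Prop :=
  IsRegularSubgradient F x 0

section Regression

variable {d d₃ n : ℕ} {Ω : Type*} [MeasurableSpace Ω]

/-- A random tensor is `ν`-sub-Gaussian: `‖⟨Z, u⟩‖_{ψ₂} ≤ √2 ν` for every unit tensor `u`. -/
def IsSubGaussianTensor (P : Measure Ω) (Z : Ω → Tensor d d₃) (ν : ℝ) : Prop :=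
  ∀ u : Tensor d d₃, ‖u‖ = 1 →
    ∫⁻ ω, ENNReal.ofReal (Real.exp (⟪Z ω, u⟫ ^ 2 / (2 * ν ^ 2))) ∂P ≤ 2

/-- The sample `(y_i, X_i)` follows the linear model `y_i = ⟨X_i, B₀⟩ + ε_i`, where the pairs
`(X_i, ε_i)` are i.i.d., `ε_i` is independent of `X_i` and `ε_i ∼ N(0, σ²)`. -/
structure IsLinearTensorSample (P : Measure Ω) (X : Fin n → Ω → Tensor d d₃)
    (y ε : Fin n → Ω → ℝ) (B₀ : Tensor d d₃) (σ : ℝ≥0) : Prop where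
  measurable_X : ∀ i, Measurable (X i)
  measurable_noise : ∀ i, Measurable (ε i)
  response : ∀ i ω, y i ω = ⟪X i ω, B₀⟫ + ε i ω
  indep : iIndepFun (fun i ω => (X i ω, ε i ω)) P
  identDistrib : ∀ i j,
    IdentDistrib (fun ω => (X i ω, ε i ω)) (fun ω => (X j ω, ε j ω)) P P
  indep_noise : ∀ i, IndepFun (X i) (ε i) P
  gaussian_noise : ∀ i, P.map (ε i) = gaussianReal 0 (σ ^ 2)

/-- The empirical squared-loss risk `L_n(B) = (1 / 2n) ∑ (y_i - ⟨X_i, B⟩)²`. -/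
def empiricalRisk (x : Fin n → Tensor d d₃) (y : Fin n → ℝ) (B : Tensor d d₃) : ℝ :=
  (1 / (2 * (n : ℝ))) * ∑ i, (y i - ⟪x i, B⟫) ^ 2

/-- The penalised objective `L_n(B) + ρ_λ(B)`. -/
def objective (x : Fin n → Tensor d d₃) (y : Fin n → ℝ) (ρ : ℝ → ℝ) (B : Tensor d d₃) : ℝ :=
  empiricalRisk x y B + B.regularizer ρ

/-- The Hessian `H_n = (1 / n) ∑ x_i x_iᵀ` of the empirical risk, with `x_i = vec(X_i)`. -/
def empiricalHessian (x : Fin n → Tensor d d₃) :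
    Matrix (Fin d × Fin d × Fin d₃) (Fin d × Fin d × Fin d₃) ℝ :=
  Matrix.of fun a b => (1 / (n : ℝ)) * ∑ i, x i a * x i b

/-- The population Hessian `H = 𝔼[H_n]`. -/
def populationHessian (P : Measure Ω) (X : Fin n → Ω → Tensor d d₃) :
    Matrix (Fin d × Fin d × Fin d₃) (Fin d × Fin d × Fin d₃) ℝ :=
  Matrix.of fun a b => ∫ ω, empiricalHessian (fun i => X i ω) a b ∂P

end Regression

/-- The smallest eigenvalue of a real symmetric matrix (of positive size). -/
def minEigenvalue {ι : Type*} [Fintype ι] [DecidableEq ι] (M : Matrix ι ι ℝ) : ℝ :=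
  sInf (spectrum ℝ M)

end

/-! Write Δ = B - B₀, L = λ C_ρ', Λ for the smallest eigenvalue of H, and Q for the empirical
quadratic form at Δ. The argument separates a deterministic inequality at a stationary point from
two uniform random bounds.

Deterministic part. Along the segment from B to B₀ the risk is exactly quadratic and the regularizer
is μ-weakly convex, so stationarity gives Q ≤ ⟨noise, Δ⟩ + ρ(B₀) - ρ(B) + (μ/2)‖Δ‖²
(`IsStationaryPoint.basic_inequality`). Low rank enters through ρ(B₀) - ρ(B) ≤ L(3√r‖Δ‖ - ‖Δ‖_*) +
(μ/2)‖Δ‖² (`Tensor.regularizer_sub_le`), proved slice by slice: ρ + (μ/2)x² is convex and even,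
hence its sum over singular values dominates its sum over any diagonal Re⟨a_i, T b_i⟩ in orthonormal
families, and ρ behaves like L|x| up to the quadratic correction. If the noise term is at most
(L/4)‖Δ‖_* and Q ≥ (2/3)Λ‖Δ‖² - (L/4)‖Δ‖_*, everything combines to ((2Λ - 3μ)/3)‖Δ‖² ≤ L(3√r‖Δ‖ -
‖Δ‖_*/2), from which the three bounds follow (`IsStationaryPoint.error_bounds`).

Random part. Up to a factor 4, the dual of the nuclear norm is a maximum over d₃·625^d explicit
atoms (`Tensor.exists_finset_inner_le`), so the noise needs only Chernoff's bound and a union bound.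
For restricted strong convexity, the lower bound on Q is proved for all sums of s atoms and carried
to the convex hull by a derandomised form of Maurey's empirical method
(`neg_le_mul_quadratic_of_mem_convexHull`). With s of order n/d this loses a multiple of (d
d₃/n)‖Δ‖_*², and `sub_mul_le_of_quadratic_slack` turns that quadratic loss into the linear slack
(L/4)‖Δ‖_* using only ‖Δ‖ ≤ β; no cone condition on Δ is needed. When n is at most a multiple of d
the slack alone suffices. -/

/-! ### Singular value decomposition and spectral functions -/

section SpectralFunctions

variable {E : Type*} [NormedAddCommGroup E] [InnerProductSpace ℂ E] [FiniteDimensional ℂ E]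

/-- A convex even function vanishing at the origin is nonnegative. -/
theorem ConvexOn.nonneg_of_even {f : ℝ → ℝ} (hf : ConvexOn ℝ Set.univ f) (he : ∀ x, f (-x) = f x)
    (h0 : f 0 = 0) (x : ℝ) : 0 ≤ f x := by
  have h := hf.2 (Set.mem_univ x) (Set.mem_univ (-x))
    (by norm_num : (0 : ℝ) ≤ 1 / 2) (by norm_num : (0 : ℝ) ≤ 1 / 2) (by norm_num)
  simp only [smul_eq_mul, he] at h
  have h2 : (1 / 2 * x + 1 / 2 * -x : ℝ) = 0 := by ring
  rw [h2, h0] at h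
  linarith

/-- Jensen's inequality for signed weights of total mass at most one and a convex even function
vanishing at the origin. -/
theorem ConvexOn.map_sum_le_of_even {κ : Type*} [Fintype κ] {f : ℝ → ℝ}
    (hf : ConvexOn ℝ Set.univ f) (he : ∀ x, f (-x) = f x) (h0 : f 0 = 0) (c s : κ → ℝ)
    (hc : ∑ k, |c k| ≤ 1) : f (∑ k, c k * s k) ≤ ∑ k, |c k| * f (s k) := by
  classical
  -- The missing mass `1 - ∑ |c k|` is placed at the point 0, where `f` vanishes; the signs of `c`
  -- move into the points and disappear by evenness.
  have key := hf.map_sum_le (t := (Finset.univ : Finset (Option κ)))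
    (w := fun o => o.elim (1 - ∑ k, |c k|) (fun k => |c k|))
    (p := fun o => o.elim 0 (fun k => SignType.sign (c k) * s k))
    (by
      rintro (_ | k) _
      · simpa using hc
      · exact abs_nonneg _)
    (by simp [Fintype.sum_option]) (fun _ _ => Set.mem_univ _)
  simp only [Fintype.sum_option, Option.elim, smul_eq_mul, mul_zero, h0, zero_add] at key
  have e1 : ∀ k, |c k| * (SignType.sign (c k) * s k) = c k * s k := by
    intro k
    rw [← mul_assoc, mul_comm |c k|, sign_mul_abs]
  have e2 : ∀ k, |c k| * f (SignType.sign (c k) * s k) = |c k| * f (s k) := by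
    intro k
    rcases lt_trichotomy (c k) 0 with h | h | h
    · simp [sign_neg h, he]
    · simp [h]
    · simp [sign_pos h]
  simpa only [e1, e2] using key

/-- A doubly substochastic (in absolute value) matrix contracts `∑ f`. -/
theorem ConvexOn.sum_map_sum_le_of_even {ι κ : Type*} [Fintype ι] [Fintype κ] {f : ℝ → ℝ}
    (hf : ConvexOn ℝ Set.univ f) (he : ∀ x, f (-x) = f x) (h0 : f 0 = 0) (c : ι → κ → ℝ)
    (s : κ → ℝ) (hrow : ∀ i, ∑ k, |c i k| ≤ 1) (hcol : ∀ k, ∑ i, |c i k| ≤ 1) :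
    ∑ i, f (∑ k, c i k * s k) ≤ ∑ k, f (s k) := by
  calc ∑ i, f (∑ k, c i k * s k) ≤ ∑ i, ∑ k, |c i k| * f (s k) :=
        Finset.sum_le_sum fun i _ => hf.map_sum_le_of_even he h0 (c i) s (hrow i)
    _ = ∑ k, (∑ i, |c i k|) * f (s k) := by
        rw [Finset.sum_comm]; simp only [Finset.sum_mul]
    _ ≤ ∑ k, f (s k) := Finset.sum_le_sum fun k _ =>
        mul_le_of_le_one_left (hf.nonneg_of_even he h0 _) (hcol k)

/-- Singular value decomposition of an endomorphism. -/
theorem LinearMap.exists_singularValueDecomposition {d : ℕ} (hd : Module.finrank ℂ E = d)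
    (T : E →ₗ[ℂ] E) : ∃ u v : OrthonormalBasis (Fin d) ℂ E,
      ∀ i : Fin d, T (v i) = ((T.singularValues i : ℝ) : ℂ) • u i := by
  classical
  set hS := T.isSymmetric_adjoint_comp_self
  set v := hS.eigenvectorBasis hd with hv
  have hTv : ∀ i j, inner ℂ (T (v i)) (T (v j)) =
      (((T.singularValues i : ℝ) ^ 2 : ℝ) : ℂ) * inner ℂ (v i) (v j) := by
    intro i j
    rw [← LinearMap.adjoint_inner_left]
    have := hS.apply_eigenvectorBasis hd i
    rw [LinearMap.comp_apply] at this
    rw [hv, this, inner_smul_left, T.sq_singularValues_fin hd]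
    simp
  -- Left singular vectors are forced only where the singular value is nonzero; there they are
  -- orthonormal, and any completion to a basis serves for the rest.
  set S : Set (Fin d) := {i | T.singularValues i ≠ 0}
  set w : Fin d → E := fun i => ((T.singularValues i : ℝ) : ℂ)⁻¹ • T (v i)
  have hw : Orthonormal ℂ (S.domRestrict w) := by
    rw [orthonormal_iff_ite]
    rintro ⟨i, hi⟩ ⟨j, hj⟩
    change inner ℂ (w i) (w j) = _
    have hi' : ((T.singularValues i : ℝ) : ℂ) ≠ 0 := by exact_mod_cast hi
    simp only [w, inner_smul_left, inner_smul_right, hTv, Subtype.mk.injEq]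
    rw [orthonormal_iff_ite.mp v.orthonormal i j]
    split_ifs with h
    · subst h
      simp only [map_inv₀, Complex.conj_ofReal]
      push_cast
      field_simp
    · simp
  obtain ⟨u, hu⟩ := hw.exists_orthonormalBasis_extension_of_card_eq (by simpa using hd)
  refine ⟨u, v, fun i => ?_⟩
  by_cases hi : T.singularValues i = 0
  · have h := hTv i i
    rw [hi] at h
    simp only [ne_eq, OfNat.ofNat_ne_zero, not_false_eq_true, zero_pow, Complex.ofReal_zero,
      zero_mul, inner_self_eq_zero] at h
    simp [hi, h]
  · rw [hu i hi]
    have hi' : ((T.singularValues i : ℝ) : ℂ) ≠ 0 := by exact_mod_cast hi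
    simp [w, smul_smul, hi']

/-- For orthonormal families `a`, `b`, the numbers `Re ⟪a i, T (b i)⟫` are dominated by the
singular values of `T`. -/
theorem LinearMap.sum_map_re_inner_le_sum_singularValues {d : ℕ} (hd : Module.finrank ℂ E = d)
    (T : E →ₗ[ℂ] E) {f : ℝ → ℝ} (hf : ConvexOn ℝ Set.univ f) (he : ∀ x, f (-x) = f x)
    (h0 : f 0 = 0) {ι : Type*} [Fintype ι] {a b : ι → E} (ha : Orthonormal ℂ a)
    (hb : Orthonormal ℂ b) :
    ∑ i, f (inner ℂ (a i) (T (b i))).re ≤ ∑ k : Fin d, f (T.singularValues k) := by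
  obtain ⟨u, v, huv⟩ := T.exists_singularValueDecomposition hd
  set c : ι → Fin d → ℝ := fun i k => (inner ℂ (v k) (b i) * inner ℂ (a i) (u k)).re
  have hre : ∀ i, (inner ℂ (a i) (T (b i))).re = ∑ k, c i k * T.singularValues k := by
    intro i
    conv_lhs => rw [← v.sum_repr' (b i), map_sum, inner_sum, Complex.re_sum]
    refine Finset.sum_congr rfl fun k _ => ?_
    rw [map_smul, huv, inner_smul_right, inner_smul_right]
    simp only [c]
    rw [mul_comm, ← Complex.re_mul_ofReal]
    ring_nf
  -- By AM-GM, Parseval along rows and Bessel along columns then make `|c|` doubly substochastic.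
  have habs : ∀ i k, |c i k| ≤ (‖inner ℂ (v k) (b i)‖ ^ 2 + ‖inner ℂ (a i) (u k)‖ ^ 2) / 2 := by
    intro i k
    refine (Complex.abs_re_le_norm _).trans ?_
    rw [norm_mul]
    nlinarith [sq_nonneg (‖inner ℂ (v k) (b i)‖ - ‖inner ℂ (a i) (u k)‖)]
  simp only [hre]
  refine hf.sum_map_sum_le_of_even he h0 c _ (fun i => ?_) fun k => ?_
  · refine (Finset.sum_le_sum fun k _ => habs i k).trans ?_
    rw [← Finset.sum_div, Finset.sum_add_distrib, v.sum_sq_norm_inner_right,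
      u.sum_sq_norm_inner_left, ha.norm_eq_one, hb.norm_eq_one]
    norm_num
  · refine (Finset.sum_le_sum fun i _ => habs i k).trans ?_
    rw [← Finset.sum_div, Finset.sum_add_distrib]
    have h1 := hb.sum_inner_products_le (v k) (s := Finset.univ)
    have h2 := ha.sum_inner_products_le (u k) (s := Finset.univ)
    simp only [v.orthonormal.norm_eq_one, u.orthonormal.norm_eq_one] at h1 h2
    have h3 : ∀ i, ‖inner ℂ (v k) (b i)‖ = ‖inner ℂ (b i) (v k)‖ := fun i => norm_inner_symm _ _
    simp only [h3]
    linarith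

/-- In the singular bases of the combination, its singular values are convex combinations of the
diagonals of `S` and `T`; each diagonal is dominated by the singular values of its own operator. -/
theorem LinearMap.sum_map_singularValues_convex {d : ℕ} (hd : Module.finrank ℂ E = d)
    {f : ℝ → ℝ} (hf : ConvexOn ℝ Set.univ f) (he : ∀ x, f (-x) = f x) (h0 : f 0 = 0)
    (S T : E →ₗ[ℂ] E) {t : ℝ} (ht0 : 0 ≤ t) (ht1 : t ≤ 1) :
    ∑ k : Fin d, f (((((1 - t : ℝ) : ℂ)) • S + ((t : ℝ) : ℂ) • T).singularValues k) ≤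
      (1 - t) * ∑ k : Fin d, f (S.singularValues k) + t * ∑ k : Fin d, f (T.singularValues k) := by
  obtain ⟨u, v, huv⟩ := ((((1 - t : ℝ) : ℂ)) • S + ((t : ℝ) : ℂ) •
    T).exists_singularValueDecomposition hd
  have hS := S.sum_map_re_inner_le_sum_singularValues hd hf he h0 u.orthonormal v.orthonormal
  have hT := T.sum_map_re_inner_le_sum_singularValues hd hf he h0 u.orthonormal v.orthonormal
  calc _ ≤ ∑ k : Fin d, ((1 - t) * f (inner ℂ (u k) (S (v k))).re +
        t * f (inner ℂ (u k) (T (v k))).re) := by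
        refine Finset.sum_le_sum fun k _ => ?_
        have h := congrArg (fun x => (inner ℂ (u k) x).re) (huv k)
        simp only [LinearMap.add_apply, LinearMap.smul_apply, inner_add_right, inner_smul_right,
          inner_self_eq_norm_sq_to_K, u.orthonormal.norm_eq_one, Complex.add_re,
          Complex.re_ofReal_mul] at h
        have h2 := hf.2 (Set.mem_univ (inner ℂ (u k) (S (v k))).re)
          (Set.mem_univ (inner ℂ (u k) (T (v k))).re) (by linarith : 0 ≤ 1 - t) ht0 (by ring)
        simp only [smul_eq_mul] at h2
        rw [h] at h2
        simpa using h2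
    _ ≤ _ := by
        rw [Finset.sum_add_distrib, ← Finset.mul_sum, ← Finset.mul_sum]
        have := mul_le_mul_of_nonneg_left hS (by linarith : 0 ≤ 1 - t)
        have := mul_le_mul_of_nonneg_left hT ht0
        linarith

theorem LinearMap.sum_sq_norm_apply_eq_adjoint {ι κ : Type*} [Fintype ι] [Fintype κ]
    (T : E →ₗ[ℂ] E) (e : OrthonormalBasis ι ℂ E) (u : OrthonormalBasis κ ℂ E) :
    ∑ i, ‖T (e i)‖ ^ 2 = ∑ k, ‖LinearMap.adjoint T (u k)‖ ^ 2 := by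
  simp_rw [← u.sum_sq_norm_inner_right (T (e _)), ← e.sum_sq_norm_inner_left (T.adjoint (u _)),
    LinearMap.adjoint_inner_left]
  exact Finset.sum_comm

theorem LinearMap.sum_sq_norm_apply_eq {ι κ : Type*} [Fintype ι] [Fintype κ]
    (T : E →ₗ[ℂ] E) (e : OrthonormalBasis ι ℂ E) (u : OrthonormalBasis κ ℂ E) :
    ∑ i, ‖T (e i)‖ ^ 2 = ∑ k, ‖T (u k)‖ ^ 2 := by
  rw [T.sum_sq_norm_apply_eq_adjoint e u, ← T.sum_sq_norm_apply_eq_adjoint u u]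

theorem LinearMap.sum_sq_singularValues {d : ℕ} (hd : Module.finrank ℂ E = d)
    {κ : Type*} [Fintype κ] (T : E →ₗ[ℂ] E) (e : OrthonormalBasis κ ℂ E) :
    ∑ k : Fin d, T.singularValues k ^ 2 = ∑ k, ‖T (e k)‖ ^ 2 := by
  obtain ⟨u, v, huv⟩ := T.exists_singularValueDecomposition hd
  rw [T.sum_sq_norm_apply_eq e v]
  refine Finset.sum_congr rfl fun k _ => ?_
  rw [huv, norm_smul, u.orthonormal.norm_eq_one]
  simp

end SpectralFunctions

/-! ### Perturbation of spectral sums around an operator of low rank -/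

section SpectralComparison

variable {E : Type*} [NormedAddCommGroup E] [InnerProductSpace ℂ E] [FiniteDimensional ℂ E]

-- The sum pairs a rank-one operator with the isometry sending one basis to the other, so it is
-- bounded by the trace norm ‖x‖‖y‖; Cauchy-Schwarz and Parseval suffice.
omit [FiniteDimensional ℂ E] in
theorem OrthonormalBasis.norm_sum_inner_mul_inner_le {κ : Type*} [Fintype κ]
    (a b : OrthonormalBasis κ ℂ E) (x y : E) :
    ‖∑ k, inner ℂ y (b k) * inner ℂ (a k) x‖ ≤ ‖y‖ * ‖x‖ := by
  calc ‖∑ k, inner ℂ y (b k) * inner ℂ (a k) x‖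
      ≤ ∑ k, ‖inner ℂ y (b k)‖ * ‖inner ℂ (a k) x‖ := by
        refine (norm_sum_le _ _).trans (le_of_eq ?_)
        simp only [norm_mul]
    _ ≤ √(∑ k, ‖inner ℂ y (b k)‖ ^ 2) * √(∑ k, ‖inner ℂ (a k) x‖ ^ 2) :=
        Real.sum_mul_le_sqrt_mul_sqrt _ _ _
    _ = ‖y‖ * ‖x‖ := by
        rw [b.sum_sq_norm_inner_left, a.sum_sq_norm_inner_right, Real.sqrt_sq (norm_nonneg _),
          Real.sqrt_sq (norm_nonneg _)]

/-- The orthogonal projection onto the span of the basis vectors indexed by `I`. -/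
noncomputable def OrthonormalBasis.coordProj {κ : Type*} [Fintype κ] (u : OrthonormalBasis κ ℂ E)
    (I : Finset κ) : E →ₗ[ℂ] E :=
  ∑ i ∈ I, (innerSL ℂ (u i)).toLinearMap.smulRight (u i)

omit [FiniteDimensional ℂ E] in
theorem OrthonormalBasis.coordProj_apply {κ : Type*} [Fintype κ] (u : OrthonormalBasis κ ℂ E)
    (I : Finset κ) (x : E) : u.coordProj I x = ∑ i ∈ I, inner ℂ (u i) x • u i := by
  simp [coordProj]

omit [FiniteDimensional ℂ E] in
theorem OrthonormalBasis.inner_coordProj {κ : Type*} [Fintype κ] [DecidableEq κ]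
    (u : OrthonormalBasis κ ℂ E) (I : Finset κ) (x : E) (i : κ) :
    inner ℂ (u i) (u.coordProj I x) = if i ∈ I then inner ℂ (u i) x else 0 := by
  simp [coordProj_apply, orthonormal_iff_ite.mp u.orthonormal]

omit [FiniteDimensional ℂ E] in
theorem OrthonormalBasis.coordProj_self {κ : Type*} [Fintype κ] [DecidableEq κ]
    (u : OrthonormalBasis κ ℂ E) (I : Finset κ) (i : κ) :
    u.coordProj I (u i) = if i ∈ I then u i else 0 := by
  simp [coordProj_apply, orthonormal_iff_ite.mp u.orthonormal]

omit [FiniteDimensional ℂ E] in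
theorem OrthonormalBasis.coordProj_add_compl {κ : Type*} [Fintype κ] [DecidableEq κ]
    (u : OrthonormalBasis κ ℂ E) (I : Finset κ) (x : E) :
    u.coordProj I x + u.coordProj Iᶜ x = x := by
  rw [coordProj_apply, coordProj_apply, Finset.sum_add_sum_compl, u.sum_repr']

omit [FiniteDimensional ℂ E] in
theorem OrthonormalBasis.norm_coordProj_le {κ : Type*} [Fintype κ]
    (u : OrthonormalBasis κ ℂ E) (I : Finset κ) (x : E) : ‖u.coordProj I x‖ ≤ ‖x‖ := by
  classical
  refine le_of_sq_le_sq ?_ (norm_nonneg _)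
  rw [← u.sum_sq_norm_inner_right, ← u.sum_sq_norm_inner_right x]
  refine Finset.sum_le_sum fun i _ => ?_
  rw [inner_coordProj]
  split_ifs
  · exact le_rfl
  · simp

theorem Finset.sum_le_sqrt_card_mul_sqrt {κ : Type*} [Fintype κ] (I : Finset κ) (g : κ → ℝ) :
    ∑ i ∈ I, g i ≤ √(I.card : ℝ) * √(∑ i, g i ^ 2) := by
  have h := Real.sum_mul_le_sqrt_mul_sqrt I (fun _ => 1) g
  simp only [one_mul, one_pow, Finset.sum_const, nsmul_eq_mul, mul_one] at h
  refine h.trans (mul_le_mul_of_nonneg_left (Real.sqrt_le_sqrt ?_) (Real.sqrt_nonneg _))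
  exact Finset.sum_le_univ_sum_of_nonneg fun i => sq_nonneg _

/-- Removing the row space spanned by `u i` and the column space spanned by `v i`, `i ∈ I`, lowers
the trace norm by at most `2 √|I|` times the Hilbert-Schmidt norm. -/
theorem LinearMap.sum_singularValues_le_compression {d : ℕ} (hd : Module.finrank ℂ E = d)
    (M : E →ₗ[ℂ] E) (u v : OrthonormalBasis (Fin d) ℂ E) (I : Finset (Fin d)) :
    ∑ k : Fin d, M.singularValues k ≤
      ∑ k : Fin d, (u.coordProj Iᶜ ∘ₗ M ∘ₗ v.coordProj Iᶜ).singularValues k +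
        2 * (√(I.card : ℝ) * √(∑ k : Fin d, M.singularValues k ^ 2)) := by
  obtain ⟨a, b, hab⟩ := M.exists_singularValueDecomposition hd
  set M' := u.coordProj Iᶜ ∘ₗ M ∘ₗ v.coordProj Iᶜ with hM'
  have hsv : ∀ k : Fin d, M.singularValues k = (inner ℂ (a k) (M (b k))).re := by
    intro k
    rw [hab, inner_smul_right, inner_self_eq_norm_sq_to_K, a.orthonormal.norm_eq_one]
    simp
  -- With P, R the projections onto the span of the `u i` and of the `v i`, `i ∈ I`: M = P^⊥ M R^⊥ +
  -- P M + P^⊥ M R. Each of the last two terms is a sum of |I| rank-one operators.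
  have hsplit : ∀ k, (inner ℂ (a k) (M (b k))).re = (inner ℂ (a k) (M' (b k))).re +
      ((∑ i ∈ I, inner ℂ (adjoint M (u i)) (b k) * inner ℂ (a k) (u i)).re +
        (∑ i ∈ I, inner ℂ (v i) (b k) * inner ℂ (a k) (u.coordProj Iᶜ (M (v i)))).re) := by
    intro k
    rw [← Complex.add_re, ← Complex.add_re]
    congr 1
    have e1 : ∑ i ∈ I, inner ℂ (adjoint M (u i)) (b k) * inner ℂ (a k) (u i) =
        inner ℂ (a k) (u.coordProj I (M (b k))) := by
      simp [OrthonormalBasis.coordProj_apply, adjoint_inner_left]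
    have e2 : ∑ i ∈ I, inner ℂ (v i) (b k) * inner ℂ (a k) (u.coordProj Iᶜ (M (v i))) =
        inner ℂ (a k) (u.coordProj Iᶜ (M (v.coordProj I (b k)))) := by
      rw [v.coordProj_apply]
      simp
    rw [e1, e2, hM', LinearMap.comp_apply, LinearMap.comp_apply, ← inner_add_right,
      ← inner_add_right]
    congr 1
    nth_rw 1 [← u.coordProj_add_compl I (M (b k))]
    nth_rw 2 [← v.coordProj_add_compl I (b k)]
    rw [map_add, map_add]
    abel
  have hn : ∀ x y : Fin d → E, ∑ k, (∑ i ∈ I, inner ℂ (y i) (b k) * inner ℂ (a k) (x i)).re ≤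
      ∑ i ∈ I, ‖y i‖ * ‖x i‖ := by
    intro x y
    rw [← Complex.re_sum, Finset.sum_comm, Complex.re_sum]
    exact Finset.sum_le_sum fun i _ =>
      (Complex.re_le_norm _).trans (a.norm_sum_inner_mul_inner_le b _ _)
  have h1 := hn u (fun i => adjoint M (u i))
  have h2 := hn (fun i => u.coordProj Iᶜ (M (v i))) v
  have h3 : ∑ i ∈ I, ‖adjoint M (u i)‖ * ‖u i‖ ≤
      √(I.card : ℝ) * √(∑ k : Fin d, M.singularValues k ^ 2) := by
    simp only [u.orthonormal.norm_eq_one, mul_one]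
    rw [M.sum_sq_singularValues hd v, M.sum_sq_norm_apply_eq_adjoint v u]
    exact I.sum_le_sqrt_card_mul_sqrt _
  have h4 : ∑ i ∈ I, ‖v i‖ * ‖u.coordProj Iᶜ (M (v i))‖ ≤
      √(I.card : ℝ) * √(∑ k : Fin d, M.singularValues k ^ 2) := by
    simp only [v.orthonormal.norm_eq_one, one_mul]
    rw [M.sum_sq_singularValues hd v]
    exact (Finset.sum_le_sum fun i _ => u.norm_coordProj_le _ _).trans
      (I.sum_le_sqrt_card_mul_sqrt _)
  have h5 : ∑ k, (inner ℂ (a k) (M' (b k))).re ≤ ∑ k : Fin d, M'.singularValues k := by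
    have := M'.sum_map_re_inner_le_sum_singularValues hd (f := fun x => |x|)
      (convexOn_norm (E := ℝ) convex_univ) (by simp) (by simp)
      a.orthonormal b.orthonormal
    simp only [abs_of_nonneg (M'.singularValues_nonneg _)] at this
    exact (Finset.sum_le_sum fun k _ => le_abs_self _).trans this
  calc ∑ k : Fin d, M.singularValues k = _ := Finset.sum_congr rfl fun k _ => (hsv k).trans
        (hsplit k)
    _ ≤ _ := by
      rw [Finset.sum_add_distrib, Finset.sum_add_distrib]
      linarith

/-- Lower bound for a spectral function at `A + M` by the values of `f` on the diagonal of the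
singular support of `A` and on the singular values of the compression of `M` to its complement. -/
theorem LinearMap.sum_map_add_compression_le {d : ℕ} (hd : Module.finrank ℂ E = d)
    (A M : E →ₗ[ℂ] E) {f : ℝ → ℝ} (hf : ConvexOn ℝ Set.univ f) (he : ∀ x, f (-x) = f x)
    (h0 : f 0 = 0) (u v : OrthonormalBasis (Fin d) ℂ E)
    (huv : ∀ i : Fin d, A (v i) = ((A.singularValues i : ℝ) : ℂ) • u i) (I : Finset (Fin d))
    (hI : ∀ i, i ∈ I ↔ A.singularValues i ≠ 0) :
    ∑ i ∈ I, f (A.singularValues i + (inner ℂ (u i) (M (v i))).re) +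
      ∑ k : Fin d, f ((u.coordProj Iᶜ ∘ₗ M ∘ₗ v.coordProj Iᶜ).singularValues k) ≤
      ∑ k : Fin d, f ((A + M).singularValues k) := by
  set M' := u.coordProj Iᶜ ∘ₗ M ∘ₗ v.coordProj Iᶜ with hM'
  obtain ⟨p, q, hpq⟩ := M'.exists_singularValueDecomposition hd
  have hMv : ∀ i ∈ I, M' (v i) = 0 := by
    intro i hi
    simp [hM', v.coordProj_self, hi]
  have huM : ∀ i ∈ I, ∀ x, inner ℂ (u i) (M' x) = 0 := by
    intro i hi x
    rw [hM', LinearMap.comp_apply, u.inner_coordProj]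
    simp [hi]
  -- Only for nonzero singular values must the singular vectors of the compression be orthogonal to
  -- `u i` and `v i`, `i ∈ I`. Joining them to these vectors gives two orthonormal families on which
  -- the diagonal of `A + M` can be read off.
  set J : Finset (Fin d) := Finset.univ.filter fun k => M'.singularValues k ≠ 0
  have hJ : ∀ k ∈ J, ((M'.singularValues k : ℝ) : ℂ) ≠ 0 := fun k hk => by
    exact_mod_cast (Finset.mem_filter.mp hk).2
  have hup : ∀ i ∈ I, ∀ k ∈ J, inner ℂ (u i) (p k) = 0 := by
    intro i hi k hk
    have h := huM i hi (q k)
    rw [hpq, inner_smul_right] at h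
    exact (mul_eq_zero.mp h).resolve_left (hJ k hk)
  have hMp : ∀ k, adjoint M' (p k) = ((M'.singularValues k : ℝ) : ℂ) • q k := by
    intro k
    refine InnerProductSpace.ext_inner_right_basis q.toBasis fun l => ?_
    rw [OrthonormalBasis.coe_toBasis, adjoint_inner_left, hpq, inner_smul_right, inner_smul_left,
      orthonormal_iff_ite.mp p.orthonormal, orthonormal_iff_ite.mp q.orthonormal]
    split_ifs with h
    · simp [h]
    · simp
  have hvq : ∀ i ∈ I, ∀ k ∈ J, inner ℂ (v i) (q k) = 0 := by
    intro i hi k hk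
    have h : inner ℂ (v i) (adjoint M' (p k)) = 0 := by
      rw [adjoint_inner_right, hMv i hi, inner_zero_left]
    rw [hMp, inner_smul_right] at h
    exact (mul_eq_zero.mp h).resolve_left (hJ k hk)
  have hAq : ∀ k ∈ J, A (q k) = 0 := by
    intro k hk
    rw [← v.sum_repr' (q k), map_sum]
    refine Finset.sum_eq_zero fun i _ => ?_
    rw [map_smul]
    by_cases hi : i ∈ I
    · rw [hvq i hi k hk, zero_smul]
    · have : A.singularValues i = 0 := by
        by_contra h
        exact hi ((hI i).2 h)
      simp [huv, this]
  have hMq : ∀ k ∈ J, inner ℂ (p k) (M (q k)) = ((M'.singularValues k : ℝ) : ℂ) := by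
    intro k hk
    have h1 : v.coordProj Iᶜ (q k) = q k := by
      have h := v.coordProj_add_compl I (q k)
      have h2 : v.coordProj I (q k) = 0 := by
        rw [v.coordProj_apply]
        exact Finset.sum_eq_zero fun i hi => by rw [hvq i hi k hk, zero_smul]
      rwa [h2, zero_add] at h
    have h3 : inner ℂ (p k) (M' (q k)) = inner ℂ (p k) (M (q k)) := by
      rw [hM', LinearMap.comp_apply, LinearMap.comp_apply, h1]
      conv_rhs => rw [← u.coordProj_add_compl I (M (q k)), inner_add_right]
      rw [u.coordProj_apply I, inner_sum, Finset.sum_eq_zero, zero_add]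
      intro i hi
      rw [inner_smul_right, ← inner_conj_symm (p k), hup i hi k hk, map_zero, mul_zero]
    rw [← h3, hpq, inner_smul_right, inner_self_eq_norm_sq_to_K, p.orthonormal.norm_eq_one]
    simp
  have horth : ∀ (w z : OrthonormalBasis (Fin d) ℂ E),
      (∀ i ∈ I, ∀ k ∈ J, inner ℂ (w i) (z k) = 0) →
      Orthonormal ℂ (Sum.elim (fun i : I => w i) (fun k : J => z k)) := by
    intro w z h
    rw [orthonormal_iff_ite]
    have hw := orthonormal_iff_ite.mp w.orthonormal
    have hz := orthonormal_iff_ite.mp z.orthonormal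
    rintro (⟨i, hi⟩ | ⟨i, hi⟩) (⟨j, hj⟩ | ⟨j, hj⟩)
    · simp [hw]
    · simp [h i hi j hj]
    · simp only [Sum.elim_inr, Sum.elim_inl, reduceCtorEq, if_false]
      rw [← inner_conj_symm, h j hj i hi, map_zero]
    · simp [hz]
  have key := (A + M).sum_map_re_inner_le_sum_singularValues hd hf he h0 (horth u p hup)
    (horth v q hvq)
  rw [Fintype.sum_sum_type] at key
  simp only [Sum.elim_inl, Sum.elim_inr] at key
  refine le_trans (le_of_eq ?_) key
  congr 1
  · rw [← Finset.sum_coe_sort I]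
    refine Finset.sum_congr rfl fun i _ => ?_
    rw [LinearMap.add_apply, huv, inner_add_right, inner_smul_right, inner_self_eq_norm_sq_to_K,
      u.orthonormal.norm_eq_one]
    simp
  · rw [← Finset.sum_subset (Finset.subset_univ J), ← Finset.sum_coe_sort J]
    · refine Finset.sum_congr rfl fun k _ => ?_
      rw [LinearMap.add_apply, hAq k k.2, zero_add, hMq k k.2, Complex.ofReal_re]
    · intro k _ hk
      have : M'.singularValues k = 0 := by
        by_contra h
        exact hk (Finset.mem_filter.mpr ⟨Finset.mem_univ _, h⟩)
      rw [this, h0]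

/-- Comparison of a weakly convex spectral penalty at `A` and at `A + M`. -/
theorem LinearMap.sum_penalty_sub_le {d : ℕ} (hd : Module.finrank ℂ E = d)
    (A M : E →ₗ[ℂ] E) {ρ : ℝ → ℝ} {μ L : ℝ} (hμ : 0 ≤ μ) (hL : 0 ≤ L)
    (hf : ConvexOn ℝ Set.univ fun x => ρ x + μ / 2 * x ^ 2) (he : ∀ x, ρ (-x) = ρ x)
    (h0 : ρ 0 = 0) (hlip : ∀ x y, ρ x - ρ y ≤ L * |x - y|)
    (hlow : ∀ x, 0 ≤ x → L * x ≤ ρ x + μ / 2 * x ^ 2) (I : Finset (Fin d))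
    (hI : ∀ i, i ∈ I ↔ A.singularValues i ≠ 0) :
    ∑ k : Fin d, ρ (A.singularValues k) - ∑ k : Fin d, ρ ((A + M).singularValues k) ≤
      L * (3 * (√(I.card : ℝ) * √(∑ k : Fin d, M.singularValues k ^ 2)) -
        ∑ k : Fin d, M.singularValues k) + μ / 2 * ∑ k : Fin d, M.singularValues k ^ 2 := by
  obtain ⟨u, v, huv⟩ := A.exists_singularValueDecomposition hd
  set M' := u.coordProj Iᶜ ∘ₗ M ∘ₗ v.coordProj Iᶜ
  set δ : Fin d → ℝ := fun i => (inner ℂ (u i) (M (v i))).re with hδ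
  have h1 := A.sum_map_add_compression_le hd M hf (fun x => by rw [he]; ring)
    (by rw [h0]; ring) u v huv I hI
  have h2 := M.sum_singularValues_le_compression hd u v I
  have hA0 : ∀ i, i ∉ I → A.singularValues i = 0 := fun i hi => by
    by_contra h
    exact hi ((hI i).2 h)
  -- The squared Hilbert-Schmidt norm of A + M, expanded in the basis `v`. Its cross term cancels
  -- the one produced by the squares (σ_i + δ_i)² in `h7`.
  have h3 : ∑ k : Fin d, (A + M).singularValues k ^ 2 = ∑ i ∈ I, A.singularValues i ^ 2 +
      2 * ∑ i ∈ I, A.singularValues i * δ i + ∑ k : Fin d, M.singularValues k ^ 2 := by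
    rw [Finset.sum_subset (f := fun i : Fin d => A.singularValues i ^ 2) (Finset.subset_univ I)
        (fun i _ hi => by simp [hA0 i hi]),
      Finset.sum_subset (f := fun i : Fin d => A.singularValues i * δ i) (Finset.subset_univ I)
        (fun i _ hi => by simp [hA0 i hi]),
      (A + M).sum_sq_singularValues hd v, M.sum_sq_singularValues hd v, Finset.mul_sum,
      ← Finset.sum_add_distrib, ← Finset.sum_add_distrib]
    refine Finset.sum_congr rfl fun k _ => ?_
    rw [LinearMap.add_apply, @norm_add_sq ℂ, huv, norm_smul, u.orthonormal.norm_eq_one,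
      inner_smul_left]
    simp [hδ]
  have h4 : ∑ k : Fin d, ρ (A.singularValues k) = ∑ i ∈ I, ρ (A.singularValues i) :=
    (Finset.sum_subset (Finset.subset_univ I) fun i _ hi => by rw [hA0 i hi, h0]).symm
  have h5 : ∑ i ∈ I, |δ i| ≤ √(I.card : ℝ) * √(∑ k : Fin d, M.singularValues k ^ 2) := by
    rw [M.sum_sq_singularValues hd v]
    refine (Finset.sum_le_sum fun i _ => ?_).trans (I.sum_le_sqrt_card_mul_sqrt _)
    refine (Complex.abs_re_le_norm _).trans ((norm_inner_le_norm _ _).trans ?_)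
    rw [u.orthonormal.norm_eq_one, one_mul]
  have h6 : L * ∑ k : Fin d, M'.singularValues k ≤
      ∑ k : Fin d, (ρ (M'.singularValues k) + μ / 2 * M'.singularValues k ^ 2) := by
    rw [Finset.mul_sum]
    exact Finset.sum_le_sum fun k _ => hlow _ (M'.singularValues_nonneg _)
  have h7 : ∑ i ∈ I, (ρ (A.singularValues i) - (ρ (A.singularValues i + δ i) +
      μ / 2 * (A.singularValues i + δ i) ^ 2) + μ / 2 * A.singularValues i ^ 2 +
        μ * (A.singularValues i * δ i)) ≤ ∑ i ∈ I, L * |δ i| := by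
    refine Finset.sum_le_sum fun i _ => ?_
    have := hlip (A.singularValues i) (A.singularValues i + δ i)
    rw [sub_add_cancel_left, abs_neg] at this
    nlinarith [mul_nonneg hμ (sq_nonneg (δ i))]
  simp only [Finset.sum_add_distrib, Finset.sum_sub_distrib, ← Finset.mul_sum] at h1 h6 h7
  have h8 := mul_le_mul_of_nonneg_left h5 hL
  -- The factor 3 is one from the diagonal perturbation `δ` (`h8`) plus two from the compression.
  have h9 := mul_le_mul_of_nonneg_left h2 hL
  rw [h4]
  rw [h3] at h1
  simp only [hδ] at *
  linarith

end SpectralComparison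

/-! ### The penalty -/

section Penalty

theorem ConvexOn.mul_le_of_hasDerivWithinAt_zero {f : ℝ → ℝ} {D : ℝ}
    (hf : ConvexOn ℝ Set.univ f) (h0 : f 0 = 0) (hD : HasDerivWithinAt f D (Set.Ici 0) 0) (x : ℝ)
    (hx : 0 ≤ x) : D * x ≤ f x := by
  rcases hx.eq_or_lt with rfl | hx
  · simp [h0]
  have h := (hf.subset (Set.subset_univ _) (convex_Ici 0)).le_slope_of_hasDerivWithinAt
    (Set.self_mem_Ici) (Set.mem_Ici.2 hx.le) hx hD
  rw [slope_def_field, h0, sub_zero, sub_zero, le_div_iff₀ hx] at h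
  exact h

variable {ρ : ℝ → ℝ} {lam μ Cρ : ℝ}

theorem IsPenalty.hasDerivWithinAt_zero (h : IsPenalty ρ lam μ Cρ) :
    HasDerivWithinAt ρ (lam * Cρ) (Set.Ici 0) 0 :=
  hasDerivWithinAt_Ici_of_tendsto_deriv (s := Set.Ioi 0)
    (fun x hx => (h.differentiableAt x (ne_of_gt hx)).differentiableWithinAt)
    h.continuous.continuousWithinAt self_mem_nhdsWithin h.tendsto_deriv

theorem IsPenalty.mul_le_add_sq (h : IsPenalty ρ lam μ Cρ) (x : ℝ) (hx : 0 ≤ x) :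
    lam * Cρ * x ≤ ρ x + μ / 2 * x ^ 2 := by
  refine h.weaklyConvex.mul_le_of_hasDerivWithinAt_zero (by simp [h.map_zero]) ?_ x hx
  have h2 : HasDerivWithinAt (fun x : ℝ => μ / 2 * x ^ 2) (μ / 2 * (2 * 0 ^ (2 - 1) * 1))
      (Set.Ici 0) 0 := by
    have := ((hasDerivAt_id (0 : ℝ)).pow 2).const_mul (μ / 2)
    simpa using this.hasDerivWithinAt
  exact (h.hasDerivWithinAt_zero.add h2).congr_deriv (by simp)

theorem IsPenalty.le_mul (h : IsPenalty ρ lam μ Cρ) (x : ℝ) (hx : 0 ≤ x) :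
    ρ x ≤ lam * Cρ * x := by
  rcases hx.eq_or_lt with rfl | hx
  · simp [h.map_zero]
  have h1 := h.concaveOn.slope_le_of_hasDerivWithinAt
    (Set.self_mem_Ici) (Set.mem_Ici.2 hx.le) hx h.hasDerivWithinAt_zero
  rwa [slope_def_field, h.map_zero, sub_zero, sub_zero, div_le_iff₀ hx] at h1

/-- Since ρ(t)/t is nonincreasing, ρ(y) and ρ(x - y) are at least the fractions y/x and (x - y)/x of
ρ(x). Hence ρ is subadditive, and the tangent at the origin bounds ρ(x - y). -/
theorem IsPenalty.sub_le_of_le (h : IsPenalty ρ lam μ Cρ) {x y : ℝ} (hy : 0 ≤ y) (hxy : y ≤ x) :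
    ρ x - ρ y ≤ lam * Cρ * (x - y) := by
  rcases hy.eq_or_lt with rfl | hy
  · simpa [h.map_zero] using h.le_mul x hxy
  rcases hxy.eq_or_lt with rfl | hxy
  · simp
  have hx := hy.trans hxy
  have h1 := h.antitoneOn_div (Set.mem_Ioi.2 hy) (Set.mem_Ioi.2 hx) hxy.le
  have h2 := h.antitoneOn_div (Set.mem_Ioi.2 (sub_pos.2 hxy)) (Set.mem_Ioi.2 hx) (by linarith)
  have h3 := h.le_mul (x - y) (by linarith)
  simp only at h1 h2
  rw [le_div_iff₀ hy] at h1
  rw [le_div_iff₀ (sub_pos.2 hxy)] at h2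
  have h4 : ρ x / x * x = ρ x := div_mul_cancel₀ _ hx.ne'
  nlinarith

theorem IsPenalty.map_abs (h : IsPenalty ρ lam μ Cρ) (x : ℝ) : ρ |x| = ρ x := by
  rcases abs_choice x with hx | hx <;> rw [hx]
  exact h.even x

theorem IsPenalty.sub_le_mul_abs (h : IsPenalty ρ lam μ Cρ) (hL : 0 ≤ lam * Cρ) (x y : ℝ) :
    ρ x - ρ y ≤ lam * Cρ * |x - y| := by
  rw [← h.map_abs x, ← h.map_abs y]
  rcases le_total |y| |x| with hxy | hxy
  · exact (h.sub_le_of_le (abs_nonneg _) hxy).trans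
      (mul_le_mul_of_nonneg_left (abs_sub_abs_le_abs_sub x y) hL)
  · have := h.monotoneOn (Set.mem_Ici.2 (abs_nonneg _)) (Set.mem_Ici.2 (abs_nonneg _)) hxy
    have := mul_nonneg hL (abs_nonneg (x - y))
    linarith

end Penalty

/-! ### Fourier slices -/

section Fourier

variable {d d₃ : ℕ}

/-- Orthogonality of characters: off the diagonal this is a full geometric sum of a `d₃`-th root of
unity other than 1. -/
theorem sum_fin_exp_mul_exp (hd₃ : 0 < d₃) (k l : Fin d₃) :
    ∑ j : Fin d₃, (starRingEnd ℂ) (Complex.exp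
        (-(2 * (Real.pi : ℂ) * Complex.I * (j : ℕ) * (k : ℕ) / (d₃ : ℂ)))) *
      Complex.exp (-(2 * (Real.pi : ℂ) * Complex.I * (j : ℕ) * (l : ℕ) / (d₃ : ℂ))) =
      if k = l then (d₃ : ℂ) else 0 := by
  have hz := (Complex.isPrimitiveRoot_exp d₃ hd₃.ne').inv
  set ζ := (Complex.exp (2 * Real.pi * Complex.I / d₃))⁻¹ with hζ
  have hζ0 : ζ ≠ 0 := hz.ne_zero hd₃.ne'
  have hpow : ∀ j m : ℕ, Complex.exp (-(2 * (Real.pi : ℂ) * Complex.I * j * m / (d₃ : ℂ))) =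
      (ζ ^ m) ^ j := by
    intro j m
    rw [hζ, ← Complex.exp_neg, ← Complex.exp_nat_mul, ← Complex.exp_nat_mul]
    congr 1
    ring
  have hconj : (starRingEnd ℂ) ζ = ζ⁻¹ := by
    rw [hζ, map_inv₀, ← Complex.exp_conj, ← Complex.exp_neg, ← Complex.exp_neg, ← Complex.exp_neg]
    congr 1
    simp only [map_div₀, map_mul, map_ofNat, Complex.conj_ofReal, Complex.conj_I, map_natCast]
    ring
  have hterm : ∀ j : Fin d₃, (starRingEnd ℂ) (Complex.exp
        (-(2 * (Real.pi : ℂ) * Complex.I * (j : ℕ) * (k : ℕ) / (d₃ : ℂ)))) *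
      Complex.exp (-(2 * (Real.pi : ℂ) * Complex.I * (j : ℕ) * (l : ℕ) / (d₃ : ℂ))) =
      (ζ ^ (l : ℕ) / ζ ^ (k : ℕ)) ^ (j : ℕ) := by
    intro j
    rw [hpow, hpow, map_pow, map_pow, hconj, div_pow, inv_pow, inv_pow, div_eq_inv_mul]
  simp only [hterm]
  rw [Fin.sum_univ_eq_sum_range (fun j => (ζ ^ (l : ℕ) / ζ ^ (k : ℕ)) ^ j)]
  split_ifs with h
  · subst h
    simp [div_self (pow_ne_zero _ hζ0)]
  · have hne : ζ ^ (l : ℕ) / ζ ^ (k : ℕ) ≠ 1 := by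
      rw [Ne, div_eq_one_iff_eq (pow_ne_zero _ hζ0)]
      intro h'
      exact h (Fin.ext (hz.pow_inj l.2 k.2 h').symm)
    rw [geom_sum_eq hne, div_pow, ← pow_mul, ← pow_mul, mul_comm (l : ℕ), mul_comm (k : ℕ),
      pow_mul, pow_mul, hz.pow_eq_one]
    simp

/-- Parseval's identity for real vectors. -/
theorem sum_fin_conj_dft_mul_dft (hd₃ : 0 < d₃) (x y : Fin d₃ → ℝ) :
    ∑ j : Fin d₃, (starRingEnd ℂ) (∑ k : Fin d₃, Complex.exp
        (-(2 * (Real.pi : ℂ) * Complex.I * (j : ℕ) * (k : ℕ) / (d₃ : ℂ))) * (x k : ℂ)) *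
      ∑ l : Fin d₃, Complex.exp
        (-(2 * (Real.pi : ℂ) * Complex.I * (j : ℕ) * (l : ℕ) / (d₃ : ℂ))) * (y l : ℂ) =
      ((d₃ * ∑ k, x k * y k : ℝ) : ℂ) := by
  simp only [map_sum, map_mul, Complex.conj_ofReal, Finset.sum_mul_sum]
  have : ∀ k l : Fin d₃, ∑ j : Fin d₃, ((starRingEnd ℂ) (Complex.exp
        (-(2 * (Real.pi : ℂ) * Complex.I * (j : ℕ) * (k : ℕ) / (d₃ : ℂ)))) * (x k : ℂ)) *
      (Complex.exp (-(2 * (Real.pi : ℂ) * Complex.I * (j : ℕ) * (l : ℕ) / (d₃ : ℂ))) * (y l : ℂ)) =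
      if k = l then (d₃ : ℂ) * (x k * y l) else 0 := by
    intro k l
    have h := congrArg (· * ((x k : ℂ) * y l)) (sum_fin_exp_mul_exp hd₃ k l)
    simp only [Finset.sum_mul, ite_mul, zero_mul] at h
    rw [← h]
    exact Finset.sum_congr rfl fun j _ => by ring
  calc _ = ∑ k : Fin d₃, ∑ l : Fin d₃, if k = l then (d₃ : ℂ) * (x k * y l) else 0 := by
        simp only [← this]
        rw [Finset.sum_comm]
        exact Finset.sum_congr rfl fun k _ => Finset.sum_comm
    _ = _ := by
        simp [Finset.mul_sum]

namespace Tensor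

/-- The `j`-th Fourier slice as an operator on `ℂ^d`. -/
noncomputable def sliceMap (T : Tensor d d₃) (j : Fin d₃) :
    EuclideanSpace ℂ (Fin d) →ₗ[ℂ] EuclideanSpace ℂ (Fin d) :=
  Matrix.toEuclideanLin (T.fourierSlice j)

theorem sv_eq (T : Tensor d d₃) (i : Fin d) (j : Fin d₃) :
    T.sv i j = (T.sliceMap j).singularValues i := rfl

theorem fourierSlice_add (S T : Tensor d d₃) (j : Fin d₃) :
    (S + T).fourierSlice j = S.fourierSlice j + T.fourierSlice j := by
  ext a b
  simp [fourierSlice, mul_add, Finset.sum_add_distrib]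

theorem fourierSlice_smul (c : ℝ) (T : Tensor d d₃) (j : Fin d₃) :
    (c • T).fourierSlice j = (c : ℂ) • T.fourierSlice j := by
  ext a b
  simp only [fourierSlice, Matrix.of_apply, Matrix.smul_apply, smul_eq_mul, Finset.mul_sum,
    PiLp.smul_apply, Complex.ofReal_mul]
  exact Finset.sum_congr rfl fun k _ => by ring

theorem sliceMap_add (S T : Tensor d d₃) (j : Fin d₃) :
    (S + T).sliceMap j = S.sliceMap j + T.sliceMap j := by
  rw [sliceMap, fourierSlice_add, map_add]; rfl

theorem sliceMap_smul (c : ℝ) (T : Tensor d d₃) (j : Fin d₃) :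
    (c • T).sliceMap j = (c : ℂ) • T.sliceMap j := by
  rw [sliceMap, fourierSlice_smul, map_smul]; rfl

theorem sliceMap_basisFun (T : Tensor d d₃) (j : Fin d₃) (a b : Fin d) :
    T.sliceMap j (EuclideanSpace.basisFun (Fin d) ℂ b) a = T.fourierSlice j a b := by
  simp [sliceMap, Matrix.toEuclideanLin, Matrix.toLpLin_apply]

/-- Parseval's identity for tensors. -/
theorem inner_eq_sum_inner_sliceMap (hd₃ : 0 < d₃) (S T : Tensor d d₃) :
    ⟪S, T⟫ = (1 / (d₃ : ℝ)) * ∑ j : Fin d₃, ∑ b : Fin d,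
      (inner ℂ (S.sliceMap j (EuclideanSpace.basisFun (Fin d) ℂ b))
        (T.sliceMap j (EuclideanSpace.basisFun (Fin d) ℂ b))).re := by
  have h1 : ∀ (j : Fin d₃) (b : Fin d),
      inner ℂ (S.sliceMap j (EuclideanSpace.basisFun (Fin d) ℂ b))
        (T.sliceMap j (EuclideanSpace.basisFun (Fin d) ℂ b)) =
      ∑ a : Fin d, (starRingEnd ℂ) (S.fourierSlice j a b) * T.fourierSlice j a b := by
    intro j b
    rw [PiLp.inner_apply]
    refine Finset.sum_congr rfl fun a _ => ?_
    rw [sliceMap_basisFun, sliceMap_basisFun, RCLike.inner_apply, mul_comm]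
  have h2 : ∀ a b : Fin d, ∑ j : Fin d₃,
      (starRingEnd ℂ) (S.fourierSlice j a b) * T.fourierSlice j a b =
        ((d₃ * ∑ k, S (a, b, k) * T (a, b, k) : ℝ) : ℂ) := fun a b =>
    sum_fin_conj_dft_mul_dft hd₃ (fun k => S (a, b, k)) (fun k => T (a, b, k))
  have h3 : ∑ j : Fin d₃, ∑ b : Fin d,
      (inner ℂ (S.sliceMap j (EuclideanSpace.basisFun (Fin d) ℂ b))
        (T.sliceMap j (EuclideanSpace.basisFun (Fin d) ℂ b))).re =
      ∑ a : Fin d, ∑ b : Fin d, (d₃ * ∑ k, S (a, b, k) * T (a, b, k) : ℝ) := by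
    simp only [h1, Complex.re_sum]
    rw [Finset.sum_comm]
    conv_lhs => enter [2, b]; rw [Finset.sum_comm]
    rw [Finset.sum_comm]
    refine Finset.sum_congr rfl fun a _ => Finset.sum_congr rfl fun b _ => ?_
    rw [← Complex.re_sum, h2, Complex.ofReal_re]
  rw [h3, PiLp.inner_apply, Fintype.sum_prod_type]
  simp only [Fintype.sum_prod_type, ← Finset.mul_sum]
  have : (d₃ : ℝ) ≠ 0 := by positivity
  rw [← mul_assoc, one_div_mul_cancel this, one_mul]
  simp [mul_comm]

theorem finrank_slice : Module.finrank ℂ (EuclideanSpace ℂ (Fin d)) = d := by simp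

theorem sv_nonneg (T : Tensor d d₃) (i : Fin d) (j : Fin d₃) : 0 ≤ T.sv i j :=
  (T.sliceMap j).singularValues_nonneg i

theorem norm_sq_eq_sum_sv (hd₃ : 0 < d₃) (T : Tensor d d₃) :
    ‖T‖ ^ 2 = (1 / (d₃ : ℝ)) * ∑ j : Fin d₃, ∑ i : Fin d, T.sv i j ^ 2 := by
  rw [← real_inner_self_eq_norm_sq, inner_eq_sum_inner_sliceMap hd₃]
  congr 1
  refine Finset.sum_congr rfl fun j _ => ?_
  simp only [sv_eq]
  rw [(T.sliceMap j).sum_sq_singularValues finrank_slice (EuclideanSpace.basisFun (Fin d) ℂ)]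
  refine Finset.sum_congr rfl fun b _ => ?_
  rw [inner_self_eq_norm_sq_to_K]
  norm_cast

end Tensor
end Fourier

/-! ### Spectral regularizers -/

namespace Tensor

variable {d d₃ : ℕ} {ρ : ℝ → ℝ} {lam μ Cρ : ℝ}

theorem regularizer_eq (ρ : ℝ → ℝ) (T : Tensor d d₃) :
    T.regularizer ρ = (1 / (d₃ : ℝ)) * ∑ j : Fin d₃, ∑ i : Fin d, ρ (T.sv i j) := by
  rw [regularizer, Finset.sum_comm]

theorem nuclearNorm_eq (T : Tensor d d₃) :
    T.nuclearNorm = (1 / (d₃ : ℝ)) * ∑ j : Fin d₃, ∑ i : Fin d, T.sv i j := by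
  rw [nuclearNorm, Finset.sum_comm]

theorem nuclearNorm_nonneg (T : Tensor d d₃) : 0 ≤ T.nuclearNorm :=
  mul_nonneg (by positivity) (Finset.sum_nonneg fun _ _ => Finset.sum_nonneg
      fun _ _ => T.sv_nonneg _ _)

/-- The ℓ² norm of the singular values is at most their ℓ¹ norm; the factor √d₃ comes from the 1/d₃
normalisation, which sits inside the square on one side only. -/
theorem norm_le_sqrt_mul_nuclearNorm (hd₃ : 0 < d₃) (T : Tensor d d₃) :
    ‖T‖ ≤ √(d₃ : ℝ) * T.nuclearNorm := by
  refine le_of_sq_le_sq ?_ (mul_nonneg (Real.sqrt_nonneg _) T.nuclearNorm_nonneg)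
  rw [mul_pow, Real.sq_sqrt (Nat.cast_nonneg _), T.norm_sq_eq_sum_sv hd₃, nuclearNorm_eq, mul_pow]
  have h : ∑ j : Fin d₃, ∑ i : Fin d, T.sv i j ^ 2 ≤ (∑ j : Fin d₃, ∑ i : Fin d, T.sv i j) ^ 2 :=
    (Finset.sum_le_sum fun j _ => Finset.sum_sq_le_sq_sum_of_nonneg
        fun i _ => T.sv_nonneg i j).trans
      (Finset.sum_sq_le_sq_sum_of_nonneg fun j _ => Finset.sum_nonneg fun i _ => T.sv_nonneg i j)
  have h' : (0 : ℝ) < d₃ := by exact_mod_cast hd₃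
  calc 1 / (d₃ : ℝ) * ∑ j : Fin d₃, ∑ i : Fin d, T.sv i j ^ 2
      ≤ 1 / (d₃ : ℝ) * (∑ j : Fin d₃, ∑ i : Fin d, T.sv i j) ^ 2 :=
        mul_le_mul_of_nonneg_left h (by positivity)
    _ = _ := by field_simp

theorem regularizer_add_sq_eq (hd₃ : 0 < d₃) (ρ : ℝ → ℝ) (μ : ℝ) (T : Tensor d d₃) :
    T.regularizer ρ + μ / 2 * ‖T‖ ^ 2 =
      (1 / (d₃ : ℝ)) * ∑ j : Fin d₃, ∑ i : Fin d, (ρ (T.sv i j) + μ / 2 * T.sv i j ^ 2) := by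
  rw [regularizer_eq, T.norm_sq_eq_sum_sv hd₃]
  simp only [Finset.sum_add_distrib, ← Finset.mul_sum]
  ring

/-- The spectral regularizer is weakly convex. -/
theorem regularizer_lineMap_le (hd₃ : 0 < d₃) (hρ : IsPenalty ρ lam μ Cρ) (S T : Tensor d d₃)
    {t : ℝ} (ht0 : 0 ≤ t) (ht1 : t ≤ 1) :
    ((1 - t) • S + t • T).regularizer ρ ≤ (1 - t) * S.regularizer ρ + t * T.regularizer ρ +
      μ / 2 * (t * (1 - t)) * ‖T - S‖ ^ 2 := by
  have key : ((1 - t) • S + t • T).regularizer ρ + μ / 2 * ‖(1 - t) • S + t • T‖ ^ 2 ≤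
      (1 - t) * (S.regularizer ρ + μ / 2 * ‖S‖ ^ 2) +
        t * (T.regularizer ρ + μ / 2 * ‖T‖ ^ 2) := by
    rw [regularizer_add_sq_eq hd₃, regularizer_add_sq_eq hd₃, regularizer_add_sq_eq hd₃,
      mul_left_comm, mul_left_comm t, ← mul_add, Finset.mul_sum _ _ (1 - t),
      Finset.mul_sum _ _ t, ← Finset.sum_add_distrib]
    refine mul_le_mul_of_nonneg_left (Finset.sum_le_sum fun j _ => ?_) (by positivity)
    have := LinearMap.sum_map_singularValues_convex finrank_slice hρ.weaklyConvex
      (fun x => by rw [hρ.even]; ring) (by rw [hρ.map_zero]; ring) (S.sliceMap j) (T.sliceMap j)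
      ht0 ht1
    rw [← sliceMap_smul, ← sliceMap_smul, ← sliceMap_add] at this
    exact this
  have hn : ‖(1 - t) • S + t • T‖ ^ 2 = (1 - t) * ‖S‖ ^ 2 + t * ‖T‖ ^ 2 -
      t * (1 - t) * ‖T - S‖ ^ 2 := by
    rw [@norm_add_sq_real, @norm_sub_sq_real, norm_smul, norm_smul, real_inner_smul_left,
      real_inner_smul_right, real_inner_comm S T, mul_pow, mul_pow, Real.norm_eq_abs,
      Real.norm_eq_abs, sq_abs, sq_abs]
    ring
  rw [hn] at key
  linarith

theorem card_support_sv_le_tubalRank (T : Tensor d d₃) (j : Fin d₃) :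
    (Finset.univ.filter fun i : Fin d => T.sv i j ≠ 0).card ≤ T.tubalRank := by
  rw [tubalRank, ← Set.ncard_coe_finset]
  refine Set.ncard_le_ncard (fun i hi => ⟨j, ?_⟩) (Set.toFinite _)
  simpa using hi

/-- Comparison of the regularizer at a tensor of low tubal rank and at a perturbation of it. -/
theorem regularizer_sub_le (hd₃ : 0 < d₃) (hρ : IsPenalty ρ lam μ Cρ) (hL : 0 ≤ lam * Cρ)
    (S Δ : Tensor d d₃) :
    S.regularizer ρ - (S + Δ).regularizer ρ ≤
      lam * Cρ * (3 * (√(S.tubalRank : ℝ) * ‖Δ‖) - Δ.nuclearNorm) + μ / 2 * ‖Δ‖ ^ 2 := by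
  have h' : (0 : ℝ) < d₃ := by exact_mod_cast hd₃
  set g : Fin d₃ → ℝ := fun j => √(∑ i : Fin d, Δ.sv i j ^ 2) with hg
  have hslice : ∀ j, ∑ i : Fin d, ρ (S.sv i j) - ∑ i : Fin d, ρ ((S + Δ).sv i j) ≤
      lam * Cρ * (3 * (√(S.tubalRank : ℝ) * g j) - ∑ i : Fin d, Δ.sv i j) +
        μ / 2 * ∑ i : Fin d, Δ.sv i j ^ 2 := by
    intro j
    have h := (S.sliceMap j).sum_penalty_sub_le finrank_slice (Δ.sliceMap j) hρ.mu_pos.le hL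
      hρ.weaklyConvex hρ.even hρ.map_zero (hρ.sub_le_mul_abs hL) hρ.mul_le_add_sq
      (Finset.univ.filter fun i : Fin d => S.sv i j ≠ 0) (fun i =>
        ⟨fun h => (Finset.mem_filter.1 h).2, fun h => Finset.mem_filter.2 ⟨Finset.mem_univ _, h⟩⟩)
    rw [← sliceMap_add] at h
    refine h.trans ?_
    refine add_le_add_left (mul_le_mul_of_nonneg_left (sub_le_sub_right (mul_le_mul_of_nonneg_left
      (mul_le_mul_of_nonneg_right (Real.sqrt_le_sqrt ?_)
          (Real.sqrt_nonneg _)) (by norm_num)) _) hL) _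
    exact_mod_cast S.card_support_sv_le_tubalRank j
  -- Cauchy-Schwarz over the slices costs √d₃ and Parseval another √d₃; the 1/d₃ in the regularizer
  -- cancels both.
  have hsum : ∑ j, g j ≤ d₃ * ‖Δ‖ := by
    have h := Finset.univ.sum_le_sqrt_card_mul_sqrt g
    have hsq : ∑ j, g j ^ 2 = d₃ * ‖Δ‖ ^ 2 := by
      rw [Δ.norm_sq_eq_sum_sv hd₃, ← mul_assoc, mul_one_div_cancel h'.ne', one_mul]
      exact Finset.sum_congr rfl fun j _ =>
        Real.sq_sqrt (Finset.sum_nonneg fun i _ => sq_nonneg _)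
    rw [hsq, Finset.card_univ, Fintype.card_fin, Real.sqrt_mul h'.le,
      Real.sqrt_sq (norm_nonneg _), ← mul_assoc, Real.mul_self_sqrt h'.le] at h
    exact h
  have htot := Finset.sum_le_sum fun j (_ : j ∈ Finset.univ) => hslice j
  simp only [Finset.sum_sub_distrib, Finset.sum_add_distrib, ← Finset.mul_sum] at htot
  have h1 : lam * Cρ * (3 * (√(S.tubalRank : ℝ) * ∑ j, g j)) ≤
      lam * Cρ * (3 * (√(S.tubalRank : ℝ) * (d₃ * ‖Δ‖))) := by gcongr
  rw [regularizer_eq, regularizer_eq, nuclearNorm_eq, Δ.norm_sq_eq_sum_sv hd₃, ← mul_sub]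
  calc _ ≤ 1 / (d₃ : ℝ) * (lam * Cρ * (3 * (√(S.tubalRank : ℝ) * (d₃ * ‖Δ‖))) -
        lam * Cρ * ∑ j : Fin d₃, ∑ i : Fin d, Δ.sv i j +
        μ / 2 * ∑ j : Fin d₃, ∑ i : Fin d, Δ.sv i j ^ 2) := by
        refine mul_le_mul_of_nonneg_left ?_ (by positivity)
        linarith
    _ = _ := by
        field_simp

/-! ### Atoms of the nuclear norm -/

/-- The tensor representing the functional `M ↦ Re ⟪u, M_j v⟫`, with `M_j` the `j`-th Fourier slice
of `M`. -/
noncomputable def atom (u v : EuclideanSpace ℂ (Fin d)) (j : Fin d₃) : Tensor d d₃ :=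
  WithLp.toLp 2 fun p => ((starRingEnd ℂ) (u p.1) *
    (Complex.exp (-(2 * (Real.pi : ℂ) * Complex.I * (j : ℕ) * (p.2.2 : ℕ) / (d₃ : ℂ))) *
      v p.2.1)).re

theorem inner_atom (M : Tensor d d₃) (u v : EuclideanSpace ℂ (Fin d)) (j : Fin d₃) :
    ⟪M, atom u v j⟫ = (inner ℂ u (M.sliceMap j v)).re := by
  have h : inner ℂ u (M.sliceMap j v) = ∑ a : Fin d, ∑ b : Fin d, ∑ k : Fin d₃,
      ((M (a, b, k) : ℝ) : ℂ) * ((starRingEnd ℂ) (u a) *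
        (Complex.exp (-(2 * (Real.pi : ℂ) * Complex.I * (j : ℕ) * (k : ℕ) / (d₃ : ℂ))) * v b)) := by
    rw [PiLp.inner_apply]
    refine Finset.sum_congr rfl fun a _ => ?_
    rw [RCLike.inner_apply, sliceMap, Matrix.toEuclideanLin, Matrix.toLpLin_apply]
    simp only [Matrix.mulVec, dotProduct, fourierSlice, Matrix.of_apply, Finset.sum_mul]
    refine Finset.sum_congr rfl fun b _ => Finset.sum_congr rfl fun k _ => ?_
    ring
  rw [h, PiLp.inner_apply, Fintype.sum_prod_type]
  simp only [Fintype.sum_prod_type, Complex.re_sum, Complex.re_ofReal_mul]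
  refine Finset.sum_congr rfl fun a _ => Finset.sum_congr rfl fun b _ =>
    Finset.sum_congr rfl fun k _ => ?_
  simp [atom, mul_comm]

/-- Each entry is the real part of a unimodular phase times an entry of a rank-one matrix, and that
matrix is repeated over d₃ slices. -/
theorem norm_atom_sq_le (u v : EuclideanSpace ℂ (Fin d)) (j : Fin d₃) (hu : ‖u‖ ≤ 1)
    (hv : ‖v‖ ≤ 1) : ‖(atom u v j : Tensor d d₃)‖ ^ 2 ≤ d₃ := by
  rw [EuclideanSpace.norm_sq_eq]
  have hexp : ∀ k : Fin d₃, ‖Complex.exp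
      (-(2 * (Real.pi : ℂ) * Complex.I * (j : ℕ) * (k : ℕ) / (d₃ : ℂ)))‖ = 1 := by
    intro k
    have : (-(2 * (Real.pi : ℂ) * Complex.I * (j : ℕ) * (k : ℕ) / (d₃ : ℂ))) =
        ((-(2 * Real.pi * j * k / d₃) : ℝ) : ℂ) * Complex.I := by
      push_cast
      ring
    rw [this, Complex.norm_exp_ofReal_mul_I]
  have hterm : ∀ (a b : Fin d) (k : Fin d₃),
      ‖(atom u v j : Tensor d d₃) (a, b, k)‖ ^ 2 ≤ ‖u a‖ ^ 2 * ‖v b‖ ^ 2 := by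
    intro a b k
    rw [← mul_pow]
    refine pow_le_pow_left₀ (norm_nonneg _) ?_ 2
    refine (Complex.abs_re_le_norm _).trans (le_of_eq ?_)
    rw [norm_mul, norm_mul, hexp, one_mul, RCLike.norm_conj]
  have hu2 : ∑ a, ‖u a‖ ^ 2 ≤ 1 := by
    rw [← EuclideanSpace.norm_sq_eq]
    nlinarith [norm_nonneg u]
  have hv2 : ∑ a, ‖v a‖ ^ 2 ≤ 1 := by
    rw [← EuclideanSpace.norm_sq_eq]
    nlinarith [norm_nonneg v]
  calc _ ≤ ∑ p : Fin d × Fin d × Fin d₃, ‖u p.1‖ ^ 2 * ‖v p.2.1‖ ^ 2 :=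
        Finset.sum_le_sum fun p _ => hterm _ _ _
    _ = d₃ * ((∑ a, ‖u a‖ ^ 2) * ∑ b, ‖v b‖ ^ 2) := by
        rw [Fintype.sum_prod_type]
        simp only [Fintype.sum_prod_type, Finset.sum_const, Finset.card_univ, Fintype.card_fin,
          nsmul_eq_mul, ← Finset.mul_sum, ← Finset.sum_mul]
        ring
    _ ≤ d₃ * 1 := by
        gcongr
        exact mul_le_one₀ hu2 (Finset.sum_nonneg fun _ _ => sq_nonneg _) hv2
    _ = d₃ := mul_one _

/-- A real normed space of finite dimension has a `1/2`-net of its unit ball of cardinality at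
most `5 ^ finrank`. -/
theorem _root_.exists_half_net_closedBall (F : Type*) [NormedAddCommGroup F] [NormedSpace ℝ F]
    [FiniteDimensional ℝ F] : ∃ s : Finset F, s.card ≤ 5 ^ Module.finrank ℝ F ∧
      (∀ x ∈ s, ‖x‖ ≤ 1) ∧ ∀ x : F, ‖x‖ ≤ 1 → ∃ y ∈ s, ‖x - y‖ ≤ 1 / 2 := by
  classical
  set S : Set ℕ := {m | ∃ s : Finset F, s.card = m ∧ (∀ x ∈ s, ‖x‖ ≤ 1) ∧
    ∀ x ∈ s, ∀ y ∈ s, x ≠ y → 1 / 2 ≤ ‖x - y‖}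
  have hbound : ∀ s : Finset F, (∀ x ∈ s, ‖x‖ ≤ 1) →
      (∀ x ∈ s, ∀ y ∈ s, x ≠ y → 1 / 2 ≤ ‖x - y‖) → s.card ≤ 5 ^ Module.finrank ℝ F := by
    intro s h1 h2
    -- Doubling gives a 1-separated set in the ball of radius 2, to which the volume count 5^dim
    -- applies.
    rw [← Finset.card_image_of_injective s (smul_right_injective F (two_ne_zero (α := ℝ)))]
    refine Besicovitch.card_le_of_separated _ ?_ ?_
    · simp only [Finset.mem_image, forall_exists_index, and_imp, forall_apply_eq_imp_iff₂]
      intro x hx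
      rw [norm_smul]
      norm_num
      linarith [h1 x hx]
    · simp only [Finset.mem_image, forall_exists_index, and_imp, forall_apply_eq_imp_iff₂]
      intro x hx y hy hxy
      have := h2 x hx y hy (fun h => hxy (by rw [h]))
      rw [← smul_sub, norm_smul]
      norm_num
      linarith
  have hne : S.Nonempty := ⟨0, ∅, by simp⟩
  have hbdd : BddAbove S := ⟨5 ^ Module.finrank ℝ F, by
    rintro m ⟨s, rfl, h1, h2⟩
    exact hbound s h1 h2⟩
  -- A separated set of maximal cardinality is a net, since an uncovered point could be added to it.
  obtain ⟨s, hs, h1, h2⟩ := Nat.sSup_mem hne hbdd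
  refine ⟨s, hbound s h1 h2, h1, fun x hx => ?_⟩
  by_contra! hcon
  have hxs : x ∉ s := fun h => by
    have := hcon x h
    simp at this
    linarith
  have hmem : (insert x s).card ∈ S := by
    refine ⟨insert x s, rfl, ?_, ?_⟩
    · simp only [Finset.mem_insert, forall_eq_or_imp]
      exact ⟨hx, h1⟩
    · intro a ha b hb hab
      rcases Finset.mem_insert.mp ha with rfl | ha' <;>
          rcases Finset.mem_insert.mp hb with rfl | hb'
      · exact absurd rfl hab
      · exact (hcon b hb').le
      · rw [norm_sub_rev]
        exact (hcon a ha').le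
      · exact h2 a ha' b hb' hab
  have := le_csSup hbdd hmem
  rw [Finset.card_insert_of_notMem hxs] at this
  omega

/-- Test `w` against its own direction: passing to the nearest net point costs at most ‖w‖/2, which
is absorbed on the left. -/
theorem _root_.norm_le_two_mul_of_half_net {E : Type*} [NormedAddCommGroup E]
    [InnerProductSpace ℂ E] {s : Finset E}
    (hs : ∀ x : E, ‖x‖ ≤ 1 → ∃ y ∈ s, ‖x - y‖ ≤ 1 / 2) (w : E) {c : ℝ}
    (hw : ∀ y ∈ s, (inner ℂ y w).re ≤ c) : ‖w‖ ≤ 2 * c := by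
  rcases eq_or_ne w 0 with rfl | hw0
  · obtain ⟨y, hy, -⟩ := hs 0 (by simp)
    have := hw y hy
    simp only [inner_zero_right, Complex.zero_re] at this
    simpa using this
  have hn : 0 < ‖w‖ := norm_pos_iff.2 hw0
  set x : E := ((‖w‖⁻¹ : ℝ) : ℂ) • w
  have hx : ‖x‖ = 1 := by
    rw [norm_smul, Complex.norm_real, norm_inv, norm_norm, inv_mul_cancel₀ hn.ne']
  obtain ⟨y, hy, hxy⟩ := hs x hx.le
  have h1 : (inner ℂ x w).re = ‖w‖ := by
    rw [inner_smul_left, Complex.conj_ofReal, Complex.re_ofReal_mul, inner_self_eq_norm_sq_to_K]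
    have : ((‖w‖ : ℂ) ^ 2).re = ‖w‖ ^ 2 := by rw [← Complex.ofReal_pow, Complex.ofReal_re]
    change ‖w‖⁻¹ * ((‖w‖ : ℂ) ^ 2).re = ‖w‖
    rw [this]
    field_simp
  have h2 : (inner ℂ (x - y) w).re ≤ 1 / 2 * ‖w‖ :=
    (Complex.re_le_norm _).trans ((norm_inner_le_norm _ _).trans (by gcongr))
  rw [inner_sub_left, Complex.sub_re, h1] at h2
  linarith [hw y hy]

/-- Duality between the nuclear norm and the functionals represented by atoms. -/
theorem inner_le_mul_nuclearNorm (hd₃ : 0 < d₃) (M Δ : Tensor d d₃) {c : ℝ}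
    (h : ∀ (j : Fin d₃) (u v : EuclideanSpace ℂ (Fin d)), ‖u‖ = 1 → ‖v‖ = 1 →
      (inner ℂ u (M.sliceMap j v)).re ≤ c) : ⟪M, Δ⟫ ≤ c * Δ.nuclearNorm := by
  rw [inner_eq_sum_inner_sliceMap hd₃, nuclearNorm_eq, mul_left_comm, Finset.mul_sum _ _ c]
  refine mul_le_mul_of_nonneg_left (Finset.sum_le_sum fun j _ => ?_)
    (by positivity : (0 : ℝ) ≤ 1 / d₃)
  obtain ⟨u, v, huv⟩ := (Δ.sliceMap j).exists_singularValueDecomposition finrank_slice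
  set e := EuclideanSpace.basisFun (Fin d) ℂ
  -- Polarisation: the Hilbert-Schmidt norm does not depend on the basis, so neither does the real
  -- inner product, and the standard basis may be replaced by the right singular basis of Δ.
  have hpol : ∀ w : OrthonormalBasis (Fin d) ℂ (EuclideanSpace ℂ (Fin d)),
      ∑ b, ‖(M.sliceMap j + Δ.sliceMap j) (w b)‖ ^ 2 = ∑ b, ‖M.sliceMap j (w b)‖ ^ 2 +
        2 * ∑ b, (inner ℂ (M.sliceMap j (w b)) (Δ.sliceMap j (w b))).re +
        ∑ b, ‖Δ.sliceMap j (w b)‖ ^ 2 := by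
    intro w
    rw [Finset.mul_sum, ← Finset.sum_add_distrib, ← Finset.sum_add_distrib]
    refine Finset.sum_congr rfl fun b _ => ?_
    rw [LinearMap.add_apply, @norm_add_sq ℂ]
    rfl
  have h1 := hpol e
  rw [(M.sliceMap j + Δ.sliceMap j).sum_sq_norm_apply_eq e v, hpol v,
    (M.sliceMap j).sum_sq_norm_apply_eq e v, (Δ.sliceMap j).sum_sq_norm_apply_eq e v] at h1
  have h2 : ∑ b, (inner ℂ (M.sliceMap j (e b)) (Δ.sliceMap j (e b))).re =
      ∑ b, (inner ℂ (M.sliceMap j (v b)) (Δ.sliceMap j (v b))).re := by linarith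
  rw [h2, Finset.mul_sum]
  refine Finset.sum_le_sum fun i _ => ?_
  rw [huv, inner_smul_right, Complex.re_ofReal_mul, mul_comm, ← inner_conj_symm, Complex.conj_re]
  exact mul_le_mul_of_nonneg_right (h j (u i) (v i) (u.orthonormal.norm_eq_one i)
    (v.orthonormal.norm_eq_one i)) (Δ.sv_nonneg i j)

/-- A finite family of tensors whose convex hull contains a quarter of the nuclear norm ball. -/
theorem exists_finset_inner_le (d : ℕ) {d₃ : ℕ} (hd₃ : 0 < d₃) :
    ∃ N : Finset (Tensor d d₃), N.card ≤ d₃ * 625 ^ d ∧ (∀ a ∈ N, ‖a‖ ^ 2 ≤ d₃) ∧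
      ∀ (M Δ : Tensor d d₃) (c : ℝ), (∀ a ∈ N, ⟪M, a⟫ ≤ c) → ⟪M, Δ⟫ ≤ 4 * c * Δ.nuclearNorm := by
  classical
  obtain ⟨s, hcard, hs1, hs2⟩ := exists_half_net_closedBall (EuclideanSpace ℂ (Fin d))
  refine ⟨((s ×ˢ s) ×ˢ (Finset.univ : Finset (Fin d₃))).image fun p => atom p.1.1 p.1.2 p.2,
    ?_, ?_, ?_⟩
  · refine Finset.card_image_le.trans ?_
    rw [finrank_real_of_complex, finrank_slice] at hcard
    rw [Finset.card_product, Finset.card_product, Finset.card_univ, Fintype.card_fin, mul_comm]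
    refine Nat.mul_le_mul_left _ ((Nat.mul_le_mul hcard hcard).trans (le_of_eq ?_))
    -- ℂ^d has real dimension 2d, so a pair of net points has at most 5^(4d) = 625^d values.
    rw [← pow_add, ← two_mul, ← mul_assoc, pow_mul]
    norm_num
  · simp only [Finset.mem_image, Finset.mem_product, forall_exists_index, and_imp]
    rintro _ p h1 h2 - rfl
    exact norm_atom_sq_le _ _ _ (hs1 _ h1) (hs1 _ h2)
  · intro M Δ c hM
    refine inner_le_mul_nuclearNorm hd₃ M Δ fun j u v hu hv => ?_
    have h1 : ∀ a ∈ s, ∀ b ∈ s, (inner ℂ a (M.sliceMap j b)).re ≤ c := by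
      intro a ha b hb
      rw [← inner_atom]
      exact hM _ (Finset.mem_image.2 ⟨((a, b), j), by simp [ha, hb], rfl⟩)
    -- The net is removed from one argument at a time, with a factor 2 each; hence the 4.
    have h2 : ∀ a ∈ s, ‖LinearMap.adjoint (M.sliceMap j) a‖ ≤ 2 * c := by
      intro a ha
      refine norm_le_two_mul_of_half_net hs2 _ fun b hb => ?_
      rw [LinearMap.adjoint_inner_right, ← inner_conj_symm, Complex.conj_re]
      exact h1 a ha b hb
    have h3 : ‖M.sliceMap j v‖ ≤ 2 * (2 * c) := by
      refine norm_le_two_mul_of_half_net hs2 _ fun a ha => ?_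
      rw [← LinearMap.adjoint_inner_left]
      refine (Complex.re_le_norm _).trans ((norm_inner_le_norm _ _).trans ?_)
      rw [hv, mul_one]
      exact h2 a ha
    refine (Complex.re_le_norm _).trans ((norm_inner_le_norm _ _).trans ?_)
    rw [hu, one_mul]
    linarith

/-- Every tensor is `4 ‖Δ‖_*` times a point of the convex hull of a family as in
`exists_finset_inner_le`. -/
theorem exists_mem_convexHull (hd₃ : 0 < d₃) {N : Finset (Tensor d d₃)}
    (hN : ∀ (M Δ : Tensor d d₃) (c : ℝ), (∀ a ∈ N, ⟪M, a⟫ ≤ c) → ⟪M, Δ⟫ ≤ 4 * c * Δ.nuclearNorm)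
    {Δ : Tensor d d₃} (hΔ : Δ ≠ 0) :
    ∃ x ∈ convexHull ℝ (N : Set (Tensor d d₃)), Δ = (4 * Δ.nuclearNorm) • x := by
  have hpos : 0 < Δ.nuclearNorm := by
    have h1 := Δ.norm_le_sqrt_mul_nuclearNorm hd₃
    have h2 := norm_pos_iff.2 hΔ
    by_contra h
    have h3 : Δ.nuclearNorm = 0 := le_antisymm (not_lt.1 h) Δ.nuclearNorm_nonneg
    rw [h3, mul_zero] at h1
    linarith
  refine ⟨(4 * Δ.nuclearNorm)⁻¹ • Δ, ?_, by rw [smul_smul, mul_inv_cancel₀ (by positivity),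
      one_smul]⟩
  by_contra hx
  -- A separating functional, represented by a tensor M, would violate the duality bound `hN`.
  obtain ⟨f, u, h1, h2⟩ := geometric_hahn_banach_closed_point (convex_convexHull ℝ _)
    (N.finite_toSet.isClosed_convexHull (𝕜 := ℝ)) hx
  set M := (InnerProductSpace.toDual ℝ (Tensor d d₃)).symm f
  have hf : ∀ y, f y = ⟪M, y⟫ := fun y => (InnerProductSpace.toDual_symm_apply).symm
  have h3 := hN M Δ u fun a ha => by
    rw [← hf]
    exact (h1 a (subset_convexHull ℝ _ ha)).le
  rw [map_smul, smul_eq_mul, hf, ← div_eq_inv_mul, lt_div_iff₀ (by positivity)] at h2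
  linarith

end Tensor

/-! ### Deterministic analysis of stationary points -/

section Deterministic

variable {d d₃ n : ℕ} {ρ : ℝ → ℝ} {lam μ Cρ : ℝ}

/-- The basic inequality at a stationary point. -/
theorem IsStationaryPoint.basic_inequality (hd₃ : 0 < d₃) (hρ : IsPenalty ρ lam μ Cρ)
    {x : Fin n → Tensor d d₃} {y ε : Fin n → ℝ} {B₀ B : Tensor d d₃}
    (hy : ∀ i, y i = ⟪x i, B₀⟫ + ε i) (hB : IsStationaryPoint (objective x y ρ) B) :
    (1 / (n : ℝ)) * ∑ i, ⟪x i, B - B₀⟫ ^ 2 ≤ ⟪(1 / (n : ℝ)) • ∑ i, ε i • x i, B - B₀⟫ +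
      (B₀.regularizer ρ - B.regularizer ρ) + μ / 2 * ‖B - B₀‖ ^ 2 := by
  set Q := (1 / (n : ℝ)) * ∑ i, ⟪x i, B - B₀⟫ ^ 2 with hQ
  have hQ0 : 0 ≤ Q := mul_nonneg (by positivity) (Finset.sum_nonneg fun _ _ => sq_nonneg _)
  set G := ⟪(1 / (n : ℝ)) • ∑ i, ε i • x i, B - B₀⟫ with hG
  have hG' : G = (1 / (n : ℝ)) * ∑ i, ε i * ⟪x i, B - B₀⟫ := by
    rw [hG, real_inner_smul_left, sum_inner]
    simp only [real_inner_smul_left]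
  have hrisk : ∀ t : ℝ, empiricalRisk x y ((1 - t) • B + t • B₀) =
      empiricalRisk x y B + t * (G - Q) + t ^ 2 / 2 * Q := by
    intro t
    rw [empiricalRisk, empiricalRisk, hG', hQ]
    have : ∀ i, (y i - ⟪x i, (1 - t) • B + t • B₀⟫) ^ 2 = (y i - ⟪x i, B⟫) ^ 2 +
        2 * t * (ε i * ⟪x i, B - B₀⟫ - ⟪x i, B - B₀⟫ ^ 2) + t ^ 2 * ⟪x i, B - B₀⟫ ^ 2 := by
      intro i
      rw [hy, inner_add_right, real_inner_smul_right, real_inner_smul_right, inner_sub_right]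
      ring
    simp only [this, Finset.sum_add_distrib, ← Finset.mul_sum, Finset.sum_sub_distrib]
    rcases eq_or_ne (n : ℝ) 0 with h | h
    · simp [h]
    · field_simp
  -- The subgradient inequality at B + t(B₀ - B) is divided by t as t tends to 0; the t²Q/2 from the
  -- risk is negligible and weak convexity leaves the term with μ/2.
  have hkey : ∀ η : ℝ, 0 < η → Q ≤ G + (B₀.regularizer ρ - B.regularizer ρ) +
      μ / 2 * ‖B - B₀‖ ^ 2 + η * (‖B - B₀‖ + 1) := by
    intro η hη
    have hcont : Tendsto (fun t : ℝ => (1 - t) • B + t • B₀) (𝓝[>] 0) (𝓝 B) := by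
      have : Continuous fun t : ℝ => (1 - t) • B + t • B₀ := by fun_prop
      simpa using (this.tendsto 0).mono_left nhdsWithin_le_nhds
    have h1 := hcont.eventually (hB η hη)
    have h2 : ∀ᶠ t : ℝ in 𝓝[>] 0, t * Q < η := by
      have : Continuous fun t : ℝ => t * Q := by fun_prop
      have h := (this.tendsto 0).mono_left (nhdsWithin_le_nhds (s := Set.Ioi 0))
      rw [zero_mul] at h
      exact h.eventually (gt_mem_nhds hη)
    have h3 : ∀ᶠ t : ℝ in 𝓝[>] 0, t ∈ Set.Ioo (0 : ℝ) 1 :=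
      Ioo_mem_nhdsGT one_pos
    obtain ⟨t, h1, h2, ht0, ht1⟩ := (h1.and (h2.and h3)).exists
    have h4 := Tensor.regularizer_lineMap_le hd₃ hρ B B₀ ht0.le ht1.le
    have h5 : (1 - t) • B + t • B₀ - B = (-t) • (B - B₀) := by module
    rw [inner_zero_left, h5, norm_smul, Real.norm_eq_abs, abs_neg, abs_of_pos ht0, objective,
      objective, hrisk] at h1
    rw [norm_sub_rev] at h4
    have h6 : t * Q ≤ t * (G + (B₀.regularizer ρ - B.regularizer ρ) +
      μ / 2 * ‖B - B₀‖ ^ 2 + η * ‖B - B₀‖ + t * Q) := by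
      have h7 : 0 ≤ μ / 2 * (t * t) * ‖B - B₀‖ ^ 2 := by
        have := hρ.mu_pos
        positivity
      have h8 : 0 ≤ t ^ 2 * Q := by positivity
      nlinarith
    have h9 := le_of_mul_le_mul_left h6 ht0
    linarith
  refine le_of_forall_pos_le_add fun e he => ?_
  have hpos : 0 < ‖B - B₀‖ + 1 := by positivity
  have := hkey (e / (‖B - B₀‖ + 1)) (by positivity)
  rwa [div_mul_cancel₀ _ hpos.ne'] at this

/-- Error bounds at a stationary point, given a bound on the noise and restricted strong convexity
in the direction of the error. -/
theorem IsStationaryPoint.error_bounds (hd₃ : 0 < d₃) (hρ : IsPenalty ρ lam μ Cρ)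
    (hL : 0 < lam * Cρ) {x : Fin n → Tensor d d₃} {y ε : Fin n → ℝ} {B₀ B : Tensor d d₃}
    (hy : ∀ i, y i = ⟪x i, B₀⟫ + ε i) (hB : IsStationaryPoint (objective x y ρ) B) {Lam : ℝ}
    (hD : 3 * μ < 2 * Lam)
    (hnoise : ⟪(1 / (n : ℝ)) • ∑ i, ε i • x i, B - B₀⟫ ≤ lam * Cρ / 4 * (B - B₀).nuclearNorm)
    (hrsc : 2 / 3 * Lam * ‖B - B₀‖ ^ 2 - lam * Cρ / 4 * (B - B₀).nuclearNorm ≤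
      (1 / (n : ℝ)) * ∑ i, ⟪x i, B - B₀⟫ ^ 2) :
    ‖B - B₀‖ ≤ 54 * (Cρ * lam * √(B₀.tubalRank : ℝ)) / (2 * Lam - 3 * μ) ∧
      (B - B₀).nuclearNorm ≤ 54 * (Cρ * lam * B₀.tubalRank) / (2 * Lam - 3 * μ) ∧
      (1 / (n : ℝ)) * ∑ i, ⟪x i, B - B₀⟫ ^ 2 ≤ Cρ ^ 2 * lam ^ 2 * B₀.tubalRank *
        (81 / (2 * Lam - 3 * μ) + 81 * μ / (2 * Lam - 3 * μ) ^ 2) := by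
  have h1 := hB.basic_inequality hd₃ hρ hy
  have h2 := Tensor.regularizer_sub_le hd₃ hρ hL.le B₀ (B - B₀)
  rw [add_sub_cancel] at h2
  have hμ := hρ.mu_pos
  have hs0 := (B - B₀).nuclearNorm_nonneg
  have hw0 := Real.sqrt_nonneg (B₀.tubalRank : ℝ)
  have ha0 := norm_nonneg (B - B₀)
  have hw2 := Real.sq_sqrt (Nat.cast_nonneg (α := ℝ) B₀.tubalRank)
  rw [← hw2]
  set Q := (1 / (n : ℝ)) * ∑ i, ⟪x i, B - B₀⟫ ^ 2
  set a := ‖B - B₀‖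
  set s := (B - B₀).nuclearNorm
  set w := √(B₀.tubalRank : ℝ)
  set L := lam * Cρ with hLdef
  have hLr : Cρ * lam = L := mul_comm _ _
  have hLr2 : Cρ ^ 2 * lam ^ 2 = L ^ 2 := by rw [hLdef]; ring
  rw [hLr, hLr2]
  set D := 2 * Lam - 3 * μ with hDdef
  have hDpos : 0 < D := by linarith
  -- One μ/2 comes from the segment and one from the penalty comparison, leaving 2Λ/3 - μ = D/3; the
  -- noise and the curvature slack each take a quarter of the nuclear norm.
  have h3 : D / 3 * a ^ 2 ≤ L * (3 * (w * a) - s / 2) := by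
    rw [hDdef]
    linarith
  have hs : s ≤ 6 * (w * a) := by
    have h4 : 0 ≤ L * (3 * (w * a) - s / 2) := le_trans (by positivity) h3
    have := nonneg_of_mul_nonneg_right h4 hL
    linarith
  have ha : a ≤ 9 * (L * w) / D := by
    rw [le_div_iff₀ hDpos]
    rcases ha0.eq_or_lt with h | h
    · rw [← h, zero_mul]
      positivity
    · have h5 : a * (a * D) ≤ a * (9 * (L * w)) := by
        nlinarith [mul_nonneg hL.le hs0]
      exact le_of_mul_le_mul_left h5 h
  refine ⟨ha.trans ?_, ?_, ?_⟩
  · rw [Real.sqrt_sq hw0]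
    gcongr
    norm_num
  · calc s ≤ 6 * (w * a) := hs
      _ ≤ 6 * (w * (9 * (L * w) / D)) := by gcongr
      _ = 54 * (L * w ^ 2) / D := by ring
  -- The basic inequality is used again, now without the lower bound on Q. The resulting 27 is
  -- rounded up to 81 so that one constant serves both terms.
  · have h6 : Q ≤ 3 * L * w * a + μ * a ^ 2 := by nlinarith [mul_nonneg hL.le hs0]
    calc Q ≤ 3 * L * w * a + μ * a ^ 2 := h6
      _ ≤ 3 * L * w * (9 * (L * w) / D) + μ * (9 * (L * w) / D) ^ 2 := by gcongr
      _ = L ^ 2 * w ^ 2 * (27 / D + 81 * μ / D ^ 2) := by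
          field_simp
          ring
      _ ≤ _ := by gcongr; norm_num

end Deterministic

/-! ### Sparse approximation of quadratic forms on convex hulls -/

section Maurey

variable {V : Type*} [AddCommGroup V] [Module ℝ V]

/-- Once q(a, a) is replaced by its bound `K`, the dependence on `a` is affine, and a linear
functional cannot exceed its value at `y` on every point of a set whose hull contains `y`. -/
theorem exists_mem_quadratic_add_le (q : V →ₗ[ℝ] V →ₗ[ℝ] ℝ) {N : Set V} {K : ℝ}
    (hK : ∀ a ∈ N, q a a ≤ K) {y : V} (hy : y ∈ convexHull ℝ N) (x : V) :
    ∃ a ∈ N, q (x + a) (x + a) ≤ q (x + y) (x + y) + (K - q y y) := by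
  by_contra! hcon
  set l : V →ₗ[ℝ] ℝ := q x + q.flip x
  have hN : N ⊆ {a | l y < l a} := by
    intro a ha
    have h1 := hcon a ha
    have h2 := hK a ha
    simp only [map_add, LinearMap.add_apply] at h1
    simp only [Set.mem_ofPred_eq, l, LinearMap.add_apply, LinearMap.flip_apply]
    linarith
  have hconv : Convex ℝ {a | l y < l a} := convex_halfSpace_gt l.isLinear _
  exact lt_irrefl (l y) (convexHull_min hN hconv hy)

/-- Maurey's sampling argument, made greedy: copies of `y` are exchanged for elements of `N` one by
one, each at cost at most K - q(y, y). -/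
theorem exists_sum_quadratic_le (q : V →ₗ[ℝ] V →ₗ[ℝ] ℝ) {N : Set V} {K : ℝ}
    (hK : ∀ a ∈ N, q a a ≤ K) {y : V} (hy : y ∈ convexHull ℝ N) (s : ℕ) (x : V) :
    ∃ f : Fin s → N, q (x + ∑ i, (f i : V)) (x + ∑ i, (f i : V)) ≤
      q (x + (s : ℝ) • y) (x + (s : ℝ) • y) + s * (K - q y y) := by
  induction s generalizing x with
  | zero => exact ⟨Fin.elim0, by simp⟩
  | succ s ih =>
    obtain ⟨f, hf⟩ := ih (x + y)
    obtain ⟨a, ha, hxa⟩ := exists_mem_quadratic_add_le q hK hy (x + ∑ i, (f i : V))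
    refine ⟨Fin.snoc f ⟨a, ha⟩, ?_⟩
    rw [Fin.sum_univ_castSucc]
    simp only [Fin.snoc_castSucc, Fin.snoc_last]
    rw [← add_assoc]
    refine hxa.trans ?_
    have e1 : x + ∑ i, (f i : V) + y = x + y + ∑ i, (f i : V) := by abel
    have e2 : x + ((s + 1 : ℕ) : ℝ) • y = x + y + (s : ℝ) • y := by
      push_cast
      module
    rw [e1, e2]
    push_cast
    linarith

/-- If a quadratic form is nonnegative on all `s`-fold sums from `N` and at most `K` on `N`, then
it is at least `-K / (s - 1)` on the convex hull of `N`. -/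
theorem neg_le_mul_quadratic_of_mem_convexHull (q : V →ₗ[ℝ] V →ₗ[ℝ] ℝ) {N : Set V} {K : ℝ}
    (hK : ∀ a ∈ N, q a a ≤ K) {s : ℕ} (hs : 0 < s)
    (hq : ∀ f : Fin s → N, 0 ≤ q (∑ i, (f i : V)) (∑ i, (f i : V))) {y : V}
    (hy : y ∈ convexHull ℝ N) : -K ≤ ((s : ℝ) - 1) * q y y := by
  obtain ⟨f, hf⟩ := exists_sum_quadratic_le q hK hy s 0
  -- The bound is now s²q(y, y) + s(K - q(y, y)) = s((s - 1)q(y, y) + K).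
  simp only [zero_add, map_smul, LinearMap.smul_apply, smul_eq_mul] at hf
  have h := (hq f).trans hf
  have hs' : (0 : ℝ) < s := by exact_mod_cast hs
  have h2 : 0 ≤ (s : ℝ) * (((s : ℝ) - 1) * q y y + K) := by linarith
  linarith [nonneg_of_mul_nonneg_right h2 hs']

end Maurey

/-! ### Restricted strong convexity from sums of finitely many atoms -/

section RestrictedStrongConvexity

variable {d d₃ n : ℕ}

theorem Tensor.nuclearNorm_zero : (0 : Tensor d d₃).nuclearNorm = 0 := by
  have h : ∀ j, (0 : Tensor d d₃).sliceMap j = 0 := fun j => by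
    have := Tensor.sliceMap_smul 0 (0 : Tensor d d₃) j
    rwa [zero_smul, Complex.ofReal_zero, zero_smul] at this
  simp [nuclearNorm, sv_eq, h]

/-- The bilinear form `(1 / n) ∑ ⟪x i, u⟫ ⟪x i, v⟫ - c ⟪u, v⟫`. -/
noncomputable def empiricalForm (x : Fin n → Tensor d d₃) (c : ℝ) :
    Tensor d d₃ →ₗ[ℝ] Tensor d d₃ →ₗ[ℝ] ℝ :=
  (1 / (n : ℝ)) • ∑ i, ((innerₗ (Tensor d d₃)) (x i)).smulRight ((innerₗ (Tensor d d₃)) (x i)) -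
    c • innerₗ (Tensor d d₃)

theorem empiricalForm_self (x : Fin n → Tensor d d₃) (c : ℝ) (u : Tensor d d₃) :
    empiricalForm x c u u = (1 / (n : ℝ)) * ∑ i, ⟪x i, u⟫ ^ 2 - c * ‖u‖ ^ 2 := by
  simp [empiricalForm, LinearMap.sum_apply, sq]

/-- Restricted strong convexity of the empirical risk, from lower bounds at finitely many sums of
atoms and upper bounds at the atoms. -/
theorem le_empirical_of_sum_atoms (hd₃ : 0 < d₃) {N : Finset (Tensor d d₃)}
    (hN : ∀ (M Δ : Tensor d d₃) (c : ℝ), (∀ a ∈ N, ⟪M, a⟫ ≤ c) → ⟪M, Δ⟫ ≤ 4 * c * Δ.nuclearNorm)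
    (x : Fin n → Tensor d d₃) {c K : ℝ} (hc : 0 ≤ c) {s : ℕ} (hs : 0 < s)
    (hK : ∀ a ∈ N, (1 / (n : ℝ)) * ∑ i, ⟪x i, a⟫ ^ 2 ≤ K)
    (hlow : ∀ f : Fin s → N, c * ‖∑ k, (f k : Tensor d d₃)‖ ^ 2 ≤
      (1 / (n : ℝ)) * ∑ i, ⟪x i, ∑ k, (f k : Tensor d d₃)⟫ ^ 2) (Δ : Tensor d d₃) :
    ((s : ℝ) - 1) * (c * ‖Δ‖ ^ 2 - (1 / (n : ℝ)) * ∑ i, ⟪x i, Δ⟫ ^ 2) ≤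
      16 * K * Δ.nuclearNorm ^ 2 := by
  rcases eq_or_ne Δ 0 with rfl | hΔ
  · simp [Tensor.nuclearNorm_zero]
  obtain ⟨y, hy, hΔy⟩ := Tensor.exists_mem_convexHull hd₃ hN hΔ
  have h := neg_le_mul_quadratic_of_mem_convexHull (empiricalForm x c) (N := (N : Set _)) (K := K)
    (fun a ha => by
      rw [empiricalForm_self]
      have := hK a ha
      have : 0 ≤ c * ‖a‖ ^ 2 := by positivity
      linarith) hs
    (fun f => by
      rw [empiricalForm_self]
      exact sub_nonneg.2 (hlow f)) hy
  have h2 : empiricalForm x c Δ Δ = (4 * Δ.nuclearNorm) ^ 2 * empiricalForm x c y y := by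
    conv_lhs => rw [hΔy]
    simp only [map_smul, LinearMap.smul_apply, smul_eq_mul]
    ring
  rw [empiricalForm_self] at h2
  have h3 := mul_le_mul_of_nonneg_left h (sq_nonneg (4 * Δ.nuclearNorm))
  linear_combination h3 - ((s : ℝ) - 1) * h2

end RestrictedStrongConvexity

/-! ### Concentration -/

section Probability

variable {d d₃ n : ℕ} {Ω : Type*} [MeasurableSpace Ω] {P : Measure Ω}

/-- Chernoff's bound for independent summands. -/
theorem measure_sum_ge_le_exp [IsProbabilityMeasure P] {Z : Fin n → Ω → ℝ}
    (hZ : ∀ i, Measurable (Z i)) (hind : iIndepFun Z P) {b : Fin n → ℝ}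
    (hb : ∀ i, ∫⁻ ω, ENNReal.ofReal (Real.exp (Z i ω)) ∂P ≤ ENNReal.ofReal (Real.exp (b i)))
    (t : ℝ) : P.real {ω | t ≤ ∑ i, Z i ω} ≤ Real.exp (∑ i, b i - t) := by
  set W : Fin n → Ω → ℝ≥0∞ := fun i ω => ENNReal.ofReal (Real.exp (Z i ω))
  have hg : Measurable fun z : ℝ => ENNReal.ofReal (Real.exp z) := by fun_prop
  have hW : ∀ i, Measurable (W i) := fun i => hg.comp (hZ i)
  have hWind : iIndepFun W P := hind.comp (fun _ z => ENNReal.ofReal (Real.exp z)) fun _ => hg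
  have hprod : ∀ (c : Fin n → ℝ), ∏ i, ENNReal.ofReal (Real.exp (c i)) =
      ENNReal.ofReal (Real.exp (∑ i, c i)) := by
    intro c
    rw [Real.exp_sum, ENNReal.ofReal_prod_of_nonneg fun i _ => (Real.exp_pos _).le]
  have h1 : ∫⁻ ω, ENNReal.ofReal (Real.exp (∑ i, Z i ω)) ∂P ≤
      ENNReal.ofReal (Real.exp (∑ i, b i)) := by
    simp only [← hprod]
    rw [lintegral_prod_eq_prod_lintegral_of_indepFun _ W hWind hW]
    exact Finset.prod_le_prod' fun i _ => hb i
  have hm : Measurable fun ω => ENNReal.ofReal (Real.exp (∑ i, Z i ω)) :=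
    hg.comp (Finset.measurable_sum _ fun i _ => hZ i)
  have h2 := (mul_meas_ge_le_lintegral (μ := P) hm (ENNReal.ofReal (Real.exp t))).trans h1
  have h3 : {ω | ENNReal.ofReal (Real.exp t) ≤ ENNReal.ofReal (Real.exp (∑ i, Z i ω))} =
      {ω | t ≤ ∑ i, Z i ω} := by
    ext ω
    simp only [Set.mem_ofPred_eq]
    rw [ENNReal.ofReal_le_ofReal_iff (Real.exp_pos _).le, Real.exp_le_exp]
  rw [h3] at h2
  have h4 := ENNReal.toReal_mono ENNReal.ofReal_ne_top h2
  rw [ENNReal.toReal_mul, ENNReal.toReal_ofReal (Real.exp_pos _).le,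
    ENNReal.toReal_ofReal (Real.exp_pos _).le] at h4
  rw [Real.exp_sub, le_div_iff₀ (Real.exp_pos _), mul_comm]
  exact h4

theorem Real.exp_mul_le_of_mem_Icc {p : ℝ} (hp0 : 0 ≤ p) (hp1 : p ≤ 1) (z : ℝ) :
    Real.exp (p * z) ≤ (1 - p) + p * Real.exp z := by
  have h := convexOn_exp.2 (Set.mem_univ 0) (Set.mem_univ z) (by linarith : 0 ≤ 1 - p) hp0
    (by ring)
  simpa using h

/-- (1 + x + x²/2)(1 - x + x²/2) = 1 + x⁴/4 ≥ 1. -/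
theorem Real.exp_neg_le_quadratic {x : ℝ} (hx : 0 ≤ x) : Real.exp (-x) ≤ 1 - x + x ^ 2 / 2 := by
  have h := Real.quadratic_le_exp_of_nonneg hx
  have h1 : 0 ≤ 1 - x + x ^ 2 / 2 := by nlinarith [sq_nonneg (x - 1)]
  rw [Real.exp_neg, inv_le_iff_one_le_mul₀ (Real.exp_pos _)]
  have h2 := mul_le_mul_of_nonneg_left h h1
  nlinarith [sq_nonneg (x ^ 2)]

variable {Z : Ω → Tensor d d₃} {ν : ℝ}

theorem measurable_inner_tensor (hZ : Measurable Z) (u : Tensor d d₃) :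
    Measurable fun ω => ⟪Z ω, u⟫ :=
  hZ.inner measurable_const

/-- Convexity of exp interpolates between the exponents 0 and 1/(2ν²) with weight p = 2ν²θ‖u‖²,
giving (1 - p) + 2p = 1 + p ≤ e^p. -/
theorem IsSubGaussianTensor.lintegral_exp_le [IsProbabilityMeasure P]
    (h : IsSubGaussianTensor P Z ν) (hZ : Measurable Z) (hν : 0 < ν) {θ : ℝ} (hθ : 0 ≤ θ)
    (u : Tensor d d₃) (hu : 2 * ν ^ 2 * θ * ‖u‖ ^ 2 ≤ 1) :
    ∫⁻ ω, ENNReal.ofReal (Real.exp (θ * ⟪Z ω, u⟫ ^ 2)) ∂P ≤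
      ENNReal.ofReal (Real.exp (2 * ν ^ 2 * θ * ‖u‖ ^ 2)) := by
  rcases eq_or_ne u 0 with rfl | hu0
  · simp
  have hn : 0 < ‖u‖ := norm_pos_iff.2 hu0
  set e : Tensor d d₃ := ‖u‖⁻¹ • u
  have he : ‖e‖ = 1 := by
    rw [norm_smul, norm_inv, norm_norm, inv_mul_cancel₀ hn.ne']
  set p := 2 * ν ^ 2 * θ * ‖u‖ ^ 2 with hp
  have hp0 : 0 ≤ p := by positivity
  have hpt : ∀ ω, θ * ⟪Z ω, u⟫ ^ 2 = p * (⟪Z ω, e⟫ ^ 2 / (2 * ν ^ 2)) := by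
    intro ω
    have : ⟪Z ω, e⟫ = ‖u‖⁻¹ * ⟪Z ω, u⟫ := real_inner_smul_right _ _ _
    rw [this, hp]
    field_simp
  calc _ ≤ ∫⁻ ω, (ENNReal.ofReal (1 - p) + ENNReal.ofReal p *
        ENNReal.ofReal (Real.exp (⟪Z ω, e⟫ ^ 2 / (2 * ν ^ 2)))) ∂P := by
        refine lintegral_mono fun ω => ?_
        rw [← ENNReal.ofReal_mul hp0, ← ENNReal.ofReal_add (by linarith) (by positivity), hpt]
        exact ENNReal.ofReal_le_ofReal (Real.exp_mul_le_of_mem_Icc hp0 hu _)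
    _ = ENNReal.ofReal (1 - p) + ENNReal.ofReal p *
        ∫⁻ ω, ENNReal.ofReal (Real.exp (⟪Z ω, e⟫ ^ 2 / (2 * ν ^ 2))) ∂P := by
        have hm := measurable_inner_tensor hZ e
        rw [lintegral_add_left measurable_const, lintegral_const_mul _ (by fun_prop)]
        simp
    _ ≤ ENNReal.ofReal (1 - p) + ENNReal.ofReal p * 2 := by
        gcongr
        exact h e he
    _ = ENNReal.ofReal (1 + p) := by
        rw [show (2 : ℝ≥0∞) = ENNReal.ofReal 2 by simp, ← ENNReal.ofReal_mul hp0,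
          ← ENNReal.ofReal_add (by linarith) (by positivity)]
        congr 1
        ring
    _ ≤ ENNReal.ofReal (Real.exp p) := by
        refine ENNReal.ofReal_le_ofReal ?_
        linarith [Real.add_one_le_exp p]

theorem IsSubGaussianTensor.integrable_exp (h : IsSubGaussianTensor P Z ν) (hZ : Measurable Z)
    {u : Tensor d d₃} (hu : ‖u‖ = 1) :
    Integrable (fun ω => Real.exp (⟪Z ω, u⟫ ^ 2 / (2 * ν ^ 2))) P ∧
      ∫ ω, Real.exp (⟪Z ω, u⟫ ^ 2 / (2 * ν ^ 2)) ∂P ≤ 2 := by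
  have hm := measurable_inner_tensor hZ u
  have hm2 : Measurable fun ω => Real.exp (⟪Z ω, u⟫ ^ 2 / (2 * ν ^ 2)) := by fun_prop
  have hi : Integrable (fun ω => Real.exp (⟪Z ω, u⟫ ^ 2 / (2 * ν ^ 2))) P := by
    refine ⟨hm2.aestronglyMeasurable, ?_⟩
    rw [hasFiniteIntegral_iff_ofReal (Eventually.of_forall fun ω => (Real.exp_pos _).le)]
    exact (h u hu).trans_lt (by simp)
  refine ⟨hi, ?_⟩
  have := h u hu
  rw [← ofReal_integral_eq_lintegral_ofReal hi
    (Eventually.of_forall fun ω => (Real.exp_pos _).le)] at this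
  exact (ENNReal.ofReal_le_ofReal_iff (by norm_num)).1
    (this.trans (le_of_eq (by simp : (2 : ℝ≥0∞) = ENNReal.ofReal 2)))

theorem IsSubGaussianTensor.integrable_sq [IsProbabilityMeasure P]
    (h : IsSubGaussianTensor P Z ν) (hZ : Measurable Z) (hν : 0 < ν) {u : Tensor d d₃}
    (hu : ‖u‖ = 1) :
    Integrable (fun ω => ⟪Z ω, u⟫ ^ 2) P ∧ ∫ ω, ⟪Z ω, u⟫ ^ 2 ∂P ≤ 2 * ν ^ 2 := by
  obtain ⟨hi, hle⟩ := h.integrable_exp hZ hu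
  have hm := measurable_inner_tensor hZ u
  have hi2 := (hi.sub (integrable_const 1)).const_mul (2 * ν ^ 2)
  have hpt : ∀ ω, ⟪Z ω, u⟫ ^ 2 ≤ 2 * ν ^ 2 * (Real.exp (⟪Z ω, u⟫ ^ 2 / (2 * ν ^ 2)) - 1) := by
    intro ω
    have := Real.add_one_le_exp (⟪Z ω, u⟫ ^ 2 / (2 * ν ^ 2))
    rw [← div_le_iff₀' (by positivity)]
    linarith
  have hint : Integrable (fun ω => ⟪Z ω, u⟫ ^ 2) P := by
    refine hi2.mono' (by fun_prop) (Eventually.of_forall fun ω => ?_)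
    rw [Real.norm_eq_abs, abs_of_nonneg (sq_nonneg _)]
    exact hpt ω
  refine ⟨hint, (integral_mono hint hi2 hpt).trans ?_⟩
  simp only [Pi.sub_apply]
  rw [integral_const_mul, integral_sub hi (integrable_const 1)]
  simp only [integral_const, probReal_univ, smul_eq_mul, mul_one]
  nlinarith [sq_nonneg ν]

theorem IsSubGaussianTensor.integrable_fourth [IsProbabilityMeasure P]
    (h : IsSubGaussianTensor P Z ν) (hZ : Measurable Z) (hν : 0 < ν) {u : Tensor d d₃}
    (hu : ‖u‖ = 1) :
    Integrable (fun ω => (⟪Z ω, u⟫ ^ 2) ^ 2) P ∧ ∫ ω, (⟪Z ω, u⟫ ^ 2) ^ 2 ∂P ≤ 8 * ν ^ 4 := by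
  obtain ⟨hi, hle⟩ := h.integrable_exp hZ hu
  have hm := measurable_inner_tensor hZ u
  have hi2 := (hi.sub (integrable_const 1)).const_mul (8 * ν ^ 4)
  have hpt : ∀ ω, (⟪Z ω, u⟫ ^ 2) ^ 2 ≤
      8 * ν ^ 4 * (Real.exp (⟪Z ω, u⟫ ^ 2 / (2 * ν ^ 2)) - 1) := by
    intro ω
    have h0 : 0 ≤ ⟪Z ω, u⟫ ^ 2 / (2 * ν ^ 2) := by positivity
    have := Real.quadratic_le_exp_of_nonneg h0
    have e : (⟪Z ω, u⟫ ^ 2) ^ 2 = 8 * ν ^ 4 * ((⟪Z ω, u⟫ ^ 2 / (2 * ν ^ 2)) ^ 2 / 2) := by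
      field_simp
      ring
    rw [e]
    refine mul_le_mul_of_nonneg_left ?_ (by positivity)
    linarith
  have hint : Integrable (fun ω => (⟪Z ω, u⟫ ^ 2) ^ 2) P := by
    refine hi2.mono' (by fun_prop) (Eventually.of_forall fun ω => ?_)
    rw [Real.norm_eq_abs, abs_of_nonneg (sq_nonneg _)]
    exact hpt ω
  refine ⟨hint, (integral_mono hint hi2 hpt).trans ?_⟩
  simp only [Pi.sub_apply]
  rw [integral_const_mul, integral_sub hi (integrable_const 1)]
  simp only [integral_const, probReal_univ, smul_eq_mul, mul_one]
  have : 0 ≤ ν ^ 4 := by positivity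
  nlinarith

/-- For a nonnegative variable the second-order bound on e^(-x) needs only a fourth moment of the
form, so the estimate holds for every `s ≥ 0` and yields the lower tail. -/
theorem IsSubGaussianTensor.lintegral_exp_neg_le [IsProbabilityMeasure P]
    (h : IsSubGaussianTensor P Z ν) (hZ : Measurable Z) (hν : 0 < ν) {s : ℝ} (hs : 0 ≤ s)
    {u : Tensor d d₃} (hu : ‖u‖ = 1) :
    ∫⁻ ω, ENNReal.ofReal (Real.exp (-(s * ⟪Z ω, u⟫ ^ 2))) ∂P ≤
      ENNReal.ofReal (Real.exp (4 * ν ^ 4 * s ^ 2 - s * ∫ ω, ⟪Z ω, u⟫ ^ 2 ∂P)) := by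
  have hm := measurable_inner_tensor hZ u
  obtain ⟨hi2, -⟩ := h.integrable_sq hZ hν hu
  obtain ⟨hi4, h4⟩ := h.integrable_fourth hZ hν hu
  have hint : Integrable (fun ω => Real.exp (-(s * ⟪Z ω, u⟫ ^ 2))) P := by
    refine (integrable_const (1 : ℝ)).mono' (by fun_prop) (Eventually.of_forall fun ω => ?_)
    rw [Real.norm_eq_abs, abs_of_pos (Real.exp_pos _), Real.exp_le_one_iff]
    have : 0 ≤ s * ⟪Z ω, u⟫ ^ 2 := by positivity
    linarith
  have hi2' := hi2.const_mul s
  have hi4' := hi4.const_mul (s ^ 2 / 2)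
  rw [← ofReal_integral_eq_lintegral_ofReal hint
    (Eventually.of_forall fun ω => (Real.exp_pos _).le)]
  refine ENNReal.ofReal_le_ofReal ?_
  calc ∫ ω, Real.exp (-(s * ⟪Z ω, u⟫ ^ 2)) ∂P
      ≤ ∫ ω, (1 - s * ⟪Z ω, u⟫ ^ 2 + s ^ 2 / 2 * (⟪Z ω, u⟫ ^ 2) ^ 2) ∂P := by
        refine integral_mono hint (((integrable_const 1).sub hi2').add hi4') fun ω => ?_
        have := Real.exp_neg_le_quadratic (x := s * ⟪Z ω, u⟫ ^ 2) (by positivity)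
        simp only
        linarith [this, mul_pow s (⟪Z ω, u⟫ ^ 2) 2]
    _ = 1 - s * ∫ ω, ⟪Z ω, u⟫ ^ 2 ∂P + s ^ 2 / 2 * ∫ ω, (⟪Z ω, u⟫ ^ 2) ^ 2 ∂P := by
        have hsub : Integrable (fun ω => 1 - s * ⟪Z ω, u⟫ ^ 2) P := (integrable_const 1).sub hi2'
        rw [integral_add hsub hi4', integral_sub (integrable_const 1) hi2',
            integral_const_mul, integral_const_mul]
        simp
    _ ≤ (4 * ν ^ 4 * s ^ 2 - s * ∫ ω, ⟪Z ω, u⟫ ^ 2 ∂P) + 1 := by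
        nlinarith [mul_le_mul_of_nonneg_left h4 (by positivity : 0 ≤ s ^ 2 / 2)]
    _ ≤ _ := Real.add_one_le_exp _

/-- Exponential moment of the product of a sub-Gaussian form and an independent Gaussian. -/
theorem IsSubGaussianTensor.lintegral_exp_mul_gaussian_le [IsProbabilityMeasure P]
    (h : IsSubGaussianTensor P Z ν) (hZ : Measurable Z) (hν : 0 < ν) {ε : Ω → ℝ}
    (hε : Measurable ε) (hind : IndepFun Z ε P) {σ : ℝ≥0} (hσ : P.map ε = gaussianReal 0 (σ ^ 2))
    (s : ℝ) (u : Tensor d d₃) (hu : ν ^ 2 * s ^ 2 * σ ^ 2 * ‖u‖ ^ 2 ≤ 1) :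
    ∫⁻ ω, ENNReal.ofReal (Real.exp (s * (ε ω * ⟪Z ω, u⟫))) ∂P ≤
      ENNReal.ofReal (Real.exp (ν ^ 2 * s ^ 2 * σ ^ 2 * ‖u‖ ^ 2)) := by
  have hm := measurable_inner_tensor hZ u
  have hind2 : IndepFun (fun ω => ⟪Z ω, u⟫) ε P :=
    hind.comp (φ := fun z : Tensor d d₃ => ⟪z, u⟫) (ψ := id) (by fun_prop) measurable_id
  have hmap := (indepFun_iff_map_prod_eq_prod_map_map hm.aemeasurable hε.aemeasurable).1 hind2
  have hF : Measurable fun p : ℝ × ℝ => ENNReal.ofReal (Real.exp (s * (p.2 * p.1))) := by fun_prop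
  -- Integrating the Gaussian first leaves the exponential of a multiple of the squared form.
  have hgauss : ∀ x : ℝ, ∫⁻ e, ENNReal.ofReal (Real.exp (s * (e * x))) ∂(gaussianReal 0 (σ ^ 2)) =
      ENNReal.ofReal (Real.exp (s ^ 2 * σ ^ 2 / 2 * x ^ 2)) := by
    intro x
    have e1 : ∀ e : ℝ, s * (e * x) = (s * x) * e := fun e => by ring
    simp only [e1]
    rw [← ofReal_integral_eq_lintegral_ofReal (integrable_exp_mul_gaussianReal _)
      (Eventually.of_forall fun ω => (Real.exp_pos _).le)]
    have := congrFun (mgf_id_gaussianReal (μ := 0) (v := σ ^ 2)) (s * x)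
    simp only [mgf, id] at this
    rw [this]
    congr 2
    push_cast
    ring
  calc _ = ∫⁻ p, ENNReal.ofReal (Real.exp (s * (p.2 * p.1)))
        ∂(P.map fun ω => (⟪Z ω, u⟫, ε ω)) := by
        rw [lintegral_map hF (hm.prodMk hε)]
    _ = ∫⁻ ω, ENNReal.ofReal (Real.exp (s ^ 2 * σ ^ 2 / 2 * ⟪Z ω, u⟫ ^ 2)) ∂P := by
        have : IsProbabilityMeasure (P.map ε) := Measure.isProbabilityMeasure_map hε.aemeasurable
        rw [hmap, lintegral_prod _ hF.aemeasurable, hσ]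
        simp only [hgauss]
        rw [lintegral_map (by fun_prop) hm]
    _ ≤ _ := by
        have e2 : 2 * ν ^ 2 * (s ^ 2 * σ ^ 2 / 2) * ‖u‖ ^ 2 = ν ^ 2 * s ^ 2 * σ ^ 2 * ‖u‖ ^ 2 := by
          ring
        rw [← e2] at hu ⊢
        exact h.lintegral_exp_le hZ hν (by positivity) u hu

end Probability

/-! ### The population Hessian -/

section Hessian

theorem Matrix.IsHermitian.minEigenvalue_mul_norm_sq_le {ι : Type*} [Fintype ι] [DecidableEq ι]
    {M : Matrix ι ι ℝ} (hM : M.IsHermitian) (x : EuclideanSpace ℝ ι) :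
    minEigenvalue M * ‖x‖ ^ 2 ≤ ∑ a, ∑ b, M a b * (x a * x b) := by
  have hle : ∀ k, minEigenvalue M ≤ hM.eigenvalues k := fun k =>
    csInf_le (by
      rw [hM.spectrum_real_eq_range_eigenvalues]
      exact (Set.finite_range _).bddBelow) (hM.eigenvalues_mem_spectrum_real k)
  have hsym := Matrix.isSymmetric_toEuclideanLin_iff.2 hM
  have hquad : ∑ a, ∑ b, M a b * (x a * x b) = ⟪x, Matrix.toEuclideanLin M x⟫ := by
    rw [PiLp.inner_apply]
    refine Finset.sum_congr rfl fun a _ => ?_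
    simp only [Matrix.toEuclideanLin, Matrix.toLpLin_apply, Matrix.mulVec, dotProduct,
      RCLike.inner_apply, conj_trivial, Finset.sum_mul]
    exact Finset.sum_congr rfl fun b _ => by ring
  have heig : ∀ k, ⟪hM.eigenvectorBasis k, Matrix.toEuclideanLin M x⟫ =
      hM.eigenvalues k * ⟪hM.eigenvectorBasis k, x⟫ := by
    intro k
    rw [← hsym]
    have : Matrix.toEuclideanLin M (hM.eigenvectorBasis k) =
        hM.eigenvalues k • hM.eigenvectorBasis k := by
      rw [Matrix.toEuclideanLin, Matrix.toLpLin_apply, hM.mulVec_eigenvectorBasis]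
      rfl
    rw [this, real_inner_smul_left]
  rw [hquad, ← hM.eigenvectorBasis.sum_inner_mul_inner x, ← hM.eigenvectorBasis.sum_sq_inner_right,
    Finset.mul_sum]
  refine Finset.sum_le_sum fun k _ => ?_
  rw [heig, real_inner_comm x]
  nlinarith [hle k, sq_nonneg ⟪hM.eigenvectorBasis k, x⟫]

variable {d d₃ n : ℕ} {Ω : Type*} [MeasurableSpace Ω] {P : Measure Ω} {ν : ℝ}

theorem IsSubGaussianTensor.integrable_inner_sq [IsProbabilityMeasure P]
    {Z : Ω → Tensor d d₃} (h : IsSubGaussianTensor P Z ν) (hZ : Measurable Z) (hν : 0 < ν)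
    (u : Tensor d d₃) : Integrable (fun ω => ⟪Z ω, u⟫ ^ 2) P := by
  rcases eq_or_ne u 0 with rfl | hu0
  · simp
  have hn : 0 < ‖u‖ := norm_pos_iff.2 hu0
  have he : ‖‖u‖⁻¹ • u‖ = 1 := by
    rw [norm_smul, norm_inv, norm_norm, inv_mul_cancel₀ hn.ne']
  refine ((h.integrable_sq hZ hν he).1.const_mul (‖u‖ ^ 2)).congr (Eventually.of_forall fun ω => ?_)
  simp only [real_inner_smul_right]
  field_simp

theorem IsSubGaussianTensor.integrable_coord_mul [IsProbabilityMeasure P]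
    {Z : Ω → Tensor d d₃} (h : IsSubGaussianTensor P Z ν) (hZ : Measurable Z) (hν : 0 < ν)
    (a b : Fin d × Fin d × Fin d₃) : Integrable (fun ω => Z ω a * Z ω b) P := by
  have hc : ∀ a, ∀ ω, ⟪Z ω, EuclideanSpace.single a (1 : ℝ)⟫ = Z ω a := fun a ω => by
    simp [EuclideanSpace.inner_single_right]
  have hm : ∀ a, Measurable fun ω => Z ω a := fun a => by
    simpa only [hc] using measurable_inner_tensor hZ (EuclideanSpace.single a (1 : ℝ))
  have ha := h.integrable_inner_sq hZ hν (EuclideanSpace.single a (1 : ℝ))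
  have hb := h.integrable_inner_sq hZ hν (EuclideanSpace.single b (1 : ℝ))
  simp only [hc] at ha hb
  refine (ha.add hb).mono' ((hm a).mul (hm b)).aestronglyMeasurable
    (Eventually.of_forall fun ω => ?_)
  rw [Real.norm_eq_abs, Pi.add_apply, abs_le]
  constructor <;> nlinarith [sq_nonneg (Z ω a - Z ω b), sq_nonneg (Z ω a + Z ω b)]

theorem isHermitian_populationHessian (P : Measure Ω) (X : Fin n → Ω → Tensor d d₃) :
    (populationHessian P X).IsHermitian := by
  ext a b
  simp only [Matrix.conjTranspose_apply, populationHessian, empiricalHessian, Matrix.of_apply,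
    star_trivial, mul_comm]

/-- The smallest eigenvalue of the population Hessian bounds second moments from below. -/
theorem minEigenvalue_populationHessian_mul_le [IsProbabilityMeasure P] (hν : 0 < ν)
    {X : Fin n → Ω → Tensor d d₃} (hX : ∀ i, Measurable (X i))
    (h : ∀ i, IsSubGaussianTensor P (X i) ν) (u : Tensor d d₃) :
    minEigenvalue (populationHessian P X) * ‖u‖ ^ 2 ≤
      (1 / (n : ℝ)) * ∑ i, ∫ ω, ⟪X i ω, u⟫ ^ 2 ∂P := by
  refine ((isHermitian_populationHessian P X).minEigenvalue_mul_norm_sq_le u).trans (le_of_eq ?_)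
  have hi := fun i a b => (h i).integrable_coord_mul (hX i) hν a b
  have h1 : ∀ a b, populationHessian P X a b = (1 / (n : ℝ)) * ∑ i, ∫ ω, X i ω a * X i ω b ∂P := by
    intro a b
    simp only [populationHessian, empiricalHessian, Matrix.of_apply]
    rw [integral_const_mul, integral_finsetSum _ fun i _ => hi i a b]
  have h2 : ∀ i, ∫ ω, ⟪X i ω, u⟫ ^ 2 ∂P = ∑ a, ∑ b, (∫ ω, X i ω a * X i ω b ∂P) * (u a * u b) := by
    intro i
    have : ∀ ω, ⟪X i ω, u⟫ ^ 2 = ∑ a, ∑ b, X i ω a * X i ω b * (u a * u b) := by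
      intro ω
      rw [PiLp.inner_apply, sq, Finset.sum_mul_sum]
      refine Finset.sum_congr rfl fun a _ => Finset.sum_congr rfl fun b _ => ?_
      simp only [RCLike.inner_apply, conj_trivial]
      ring
    simp only [this]
    rw [integral_finsetSum _ fun a _ => integrable_finsetSum _ fun b _ => (hi i a b).mul_const _]
    refine Finset.sum_congr rfl fun a _ => ?_
    rw [integral_finsetSum _ fun b _ => (hi i a b).mul_const _]
    exact Finset.sum_congr rfl fun b _ => integral_mul_const _ _
  simp only [h1, h2, mul_assoc, Finset.sum_mul]
  simp only [← Finset.mul_sum]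
  congr 1
  rw [Finset.sum_comm]
  conv_lhs => enter [2, b]; rw [Finset.sum_comm]
  rw [Finset.sum_comm]
  conv_lhs => enter [2, b]; rw [Finset.sum_comm]

/-- Tested on one coordinate. This caps the curvature term by ν² wherever the nuclear norm slack has
to dominate it. -/
theorem minEigenvalue_populationHessian_le [IsProbabilityMeasure P] (hd : 0 < d) (hd₃ : 0 < d₃)
    (hn : 0 < n) (hν : 0 < ν) {X : Fin n → Ω → Tensor d d₃} (hX : ∀ i, Measurable (X i))
    (h : ∀ i, IsSubGaussianTensor P (X i) ν) :
    minEigenvalue (populationHessian P X) ≤ 2 * ν ^ 2 := by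
  have hu : ‖(EuclideanSpace.single (⟨0, hd⟩, ⟨0, hd⟩, ⟨0, hd₃⟩) (1 : ℝ) : Tensor d d₃)‖ = 1 := by
    simp
  have h1 := minEigenvalue_populationHessian_mul_le hν hX h
    (EuclideanSpace.single (⟨0, hd⟩, ⟨0, hd⟩, ⟨0, hd₃⟩) (1 : ℝ))
  have h2 := Finset.sum_le_sum fun i (_ : i ∈ Finset.univ) => ((h i).integrable_sq (hX i) hν hu).2
  rw [hu] at h1
  simp only [Finset.sum_const, Finset.card_univ, Fintype.card_fin, nsmul_eq_mul] at h2
  have hn' : (0 : ℝ) < n := by exact_mod_cast hn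
  calc _ ≤ (1 / (n : ℝ)) * (n * (2 * ν ^ 2)) := by
        rw [one_pow, mul_one] at h1
        exact h1.trans (mul_le_mul_of_nonneg_left h2 (by positivity))
    _ = _ := by field_simp

end Hessian

/-! ### Probability of the good events -/

section Events

variable {d d₃ n : ℕ} {Ω : Type*} [MeasurableSpace Ω] {P : Measure Ω} [IsProbabilityMeasure P]
  {X : Fin n → Ω → Tensor d d₃} {y ε : Fin n → Ω → ℝ} {B₀ : Tensor d d₃} {σ : ℝ≥0} {ν : ℝ}

/-- Upper tail of the noise in a fixed direction. -/
theorem IsLinearTensorSample.measure_noise_gt_le (hS : IsLinearTensorSample P X y ε B₀ σ)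
    (hX : ∀ i, IsSubGaussianTensor P (X i) ν) (hν : 0 < ν) (a : Tensor d d₃) {s : ℝ} (hs : 0 < s)
    (hsa : ν ^ 2 * s ^ 2 * σ ^ 2 * ‖a‖ ^ 2 ≤ 1) (t : ℝ) :
    P.real {ω | t < ⟪(1 / (n : ℝ)) • ∑ i, ε i ω • X i ω, a⟫} ≤
      Real.exp (n * (ν ^ 2 * s ^ 2 * σ ^ 2 * ‖a‖ ^ 2) - s * n * t) := by
  rcases Nat.eq_zero_or_pos n with rfl | hn
  · simp [measureReal_le_one]
  have hn' : (0 : ℝ) < n := by exact_mod_cast hn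
  have hg : Measurable fun p : Tensor d d₃ × ℝ => s * (p.2 * ⟪p.1, a⟫) := by fun_prop
  have h := measure_sum_ge_le_exp (P := P) (Z := fun i ω => s * (ε i ω * ⟪X i ω, a⟫))
    (fun i => hg.comp ((hS.measurable_X i).prodMk (hS.measurable_noise i)))
    (hS.indep.comp (fun _ p => s * (p.2 * ⟪p.1, a⟫)) fun _ => hg)
    (fun i => (hX i).lintegral_exp_mul_gaussian_le (hS.measurable_X i) hν (hS.measurable_noise i)
      (hS.indep_noise i) (hS.gaussian_noise i) s a hsa) (s * n * t)
  simp only [Finset.sum_const, Finset.card_univ, Fintype.card_fin, nsmul_eq_mul] at h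
  refine (measureReal_mono ?_).trans h
  intro ω hω
  simp only [Set.mem_ofPred_eq] at hω ⊢
  rw [real_inner_smul_left, sum_inner] at hω
  simp only [real_inner_smul_left] at hω
  rw [← Finset.mul_sum, mul_assoc]
  refine mul_le_mul_of_nonneg_left ?_ hs.le
  rw [one_div, ← div_eq_inv_mul, lt_div_iff₀ hn'] at hω
  linarith

/-- Upper tail of the empirical second moment in a fixed direction. -/
theorem IsLinearTensorSample.measure_empirical_gt_le (hS : IsLinearTensorSample P X y ε B₀ σ)
    (hX : ∀ i, IsSubGaussianTensor P (X i) ν) (hν : 0 < ν) (hn : 0 < n) (a : Tensor d d₃) {D : ℝ}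
    (hD : 0 < D) (ha : ‖a‖ ^ 2 ≤ D) :
    P.real {ω | 4 * ν ^ 2 * D < (1 / (n : ℝ)) * ∑ i, ⟪X i ω, a⟫ ^ 2} ≤ Real.exp (-n) := by
  have hn' : (0 : ℝ) < n := by exact_mod_cast hn
  -- The largest parameter admissible for every ‖a‖² ≤ D; each summand then costs at most 1 against
  -- a threshold of 2 per summand.
  set θ := 1 / (2 * ν ^ 2 * D) with hθ
  have hθ0 : 0 < θ := by positivity
  have hθa : 2 * ν ^ 2 * θ * ‖a‖ ^ 2 ≤ 1 := by
    have : 2 * ν ^ 2 * θ * ‖a‖ ^ 2 = ‖a‖ ^ 2 / D := by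
      rw [hθ]
      field_simp
    rw [this]
    exact div_le_one_of_le₀ ha hD.le
  have hg : Measurable fun p : Tensor d d₃ × ℝ => θ * ⟪p.1, a⟫ ^ 2 := by fun_prop
  have h := measure_sum_ge_le_exp (P := P) (Z := fun i ω => θ * ⟪X i ω, a⟫ ^ 2) (b := fun _ => 1)
    (fun i => hg.comp ((hS.measurable_X i).prodMk (hS.measurable_noise i)))
    (hS.indep.comp (fun _ p => θ * ⟪p.1, a⟫ ^ 2) fun _ => hg)
    (fun i => ((hX i).lintegral_exp_le (hS.measurable_X i) hν hθ0.le a hθa).trans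
      (ENNReal.ofReal_le_ofReal (Real.exp_le_exp.2 hθa))) (2 * n)
  simp only [Finset.sum_const, Finset.card_univ, Fintype.card_fin, nsmul_eq_mul, mul_one] at h
  refine (measureReal_mono ?_).trans (h.trans (le_of_eq ?_))
  · intro ω hω
    simp only [Set.mem_ofPred_eq] at hω ⊢
    rw [one_div, ← div_eq_inv_mul, lt_div_iff₀ hn'] at hω
    rw [← Finset.mul_sum, hθ, one_div, ← div_eq_inv_mul, le_div_iff₀ (by positivity)]
    linarith
  · congr 1
    ring

/-- Lower tail of the empirical second moment in a fixed direction. -/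
theorem IsLinearTensorSample.measure_empirical_lt_le (hS : IsLinearTensorSample P X y ε B₀ σ)
    (hX : ∀ i, IsSubGaussianTensor P (X i) ν) (hν : 0 < ν) (hn : 0 < n) {κ : ℝ} (hκ : 0 < κ)
    (hLam : κ ≤ minEigenvalue (populationHessian P X)) (u : Tensor d d₃) :
    P.real {ω | (1 / (n : ℝ)) * ∑ i, ⟪X i ω, u⟫ ^ 2 <
      2 / 3 * minEigenvalue (populationHessian P X) * ‖u‖ ^ 2} ≤
      Real.exp (-(κ ^ 2 / (144 * ν ^ 4) * n)) := by
  have hn' : (0 : ℝ) < n := by exact_mod_cast hn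
  rcases eq_or_ne u 0 with rfl | hu0
  · simp [Real.exp_nonneg]
  have hpos : 0 < ‖u‖ := norm_pos_iff.2 hu0
  set e : Tensor d d₃ := ‖u‖⁻¹ • u
  have he : ‖e‖ = 1 := by
    rw [norm_smul, norm_inv, norm_norm, inv_mul_cancel₀ hpos.ne']
  have hue : ∀ ω i, ⟪X i ω, u⟫ ^ 2 = ‖u‖ ^ 2 * ⟪X i ω, e⟫ ^ 2 := by
    intro ω i
    have : ⟪X i ω, e⟫ = ‖u‖⁻¹ * ⟪X i ω, u⟫ := real_inner_smul_right _ _ _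
    rw [this]
    field_simp
  set Lam := minEigenvalue (populationHessian P X)
  have hmean : n * Lam ≤ ∑ i, ∫ ω, ⟪X i ω, e⟫ ^ 2 ∂P := by
    have h := minEigenvalue_populationHessian_mul_le hν hS.measurable_X hX e
    rw [he, one_pow, mul_one, one_div, ← div_eq_inv_mul, le_div_iff₀ hn'] at h
    linarith
  -- The gap between Λ and 2Λ/3 gains at least sκ/3 per observation, and this `s` makes the
  -- second-order cost 4ν⁴s² equal to sκ/6, leaving sκ/6 = κ²/(144ν⁴).
  set s := κ / (24 * ν ^ 4) with hs
  have hs0 : 0 < s := by positivity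
  have hg : Measurable fun p : Tensor d d₃ × ℝ => -(s * ⟪p.1, e⟫ ^ 2) := by fun_prop
  have h := measure_sum_ge_le_exp (P := P) (Z := fun i ω => -(s * ⟪X i ω, e⟫ ^ 2))
    (fun i => hg.comp ((hS.measurable_X i).prodMk (hS.measurable_noise i)))
    (hS.indep.comp (fun _ p => -(s * ⟪p.1, e⟫ ^ 2)) fun _ => hg)
    (fun i => (hX i).lintegral_exp_neg_le (hS.measurable_X i) hν hs0.le he)
    (-(s * (n * (2 / 3 * Lam))))
  refine (measureReal_mono ?_).trans (h.trans (Real.exp_le_exp.2 ?_))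
  · intro ω hω
    simp only [Set.mem_ofPred_eq, hue, ← Finset.mul_sum] at hω
    have h1 : (1 / (n : ℝ)) * ∑ i, ⟪X i ω, e⟫ ^ 2 < 2 / 3 * Lam := by
      rw [mul_left_comm, mul_comm (2 / 3 * Lam)] at hω
      exact lt_of_mul_lt_mul_left hω (by positivity)
    rw [one_div, ← div_eq_inv_mul, div_lt_iff₀ hn'] at h1
    simp only [Set.mem_ofPred_eq, Finset.sum_neg_distrib, ← Finset.mul_sum]
    nlinarith
  · simp only [Finset.sum_sub_distrib, Finset.sum_const, Finset.card_univ, Fintype.card_fin,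
      nsmul_eq_mul, ← Finset.mul_sum]
    have h2 := mul_le_mul_of_nonneg_left hmean hs0.le
    have h3 : s * (n * κ) ≤ s * (n * Lam) := by gcongr
    have h4 : n * (4 * ν ^ 4 * s ^ 2) = s * (n * κ) / 6 := by
      rw [hs]
      field_simp
      norm_num
    have h5 : κ ^ 2 / (144 * ν ^ 4) * n = s * (n * κ) / 6 := by
      rw [hs]
      field_simp
      norm_num
    rw [h5]
    linarith

omit [IsProbabilityMeasure P] in
theorem measureReal_setOf_exists_mem_le {α : Type*} (s : Finset α) (S : α → Set Ω) {p : ℝ}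
    (h : ∀ a ∈ s, P.real (S a) ≤ p) : P.real {ω | ∃ a ∈ s, ω ∈ S a} ≤ s.card * p := by
  have he : {ω | ∃ a ∈ s, ω ∈ S a} = ⋃ a ∈ s, S a := by
    ext ω
    simp
  rw [he]
  refine (measureReal_biUnion_finset_le s S).trans ((Finset.sum_le_sum h).trans (le_of_eq ?_))
  rw [Finset.sum_const, nsmul_eq_mul]

end Events

/-! ### Union bounds and the good event -/

section GoodEvents

theorem natCast_card_le_mul_exp {d d₃ c : ℕ} (h : c ≤ d₃ * 625 ^ d) :
    (c : ℝ) ≤ d₃ * Real.exp (7 * d) := by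
  have h1 : (625 : ℝ) ≤ Real.exp 7 := by
    have h2 : (2.7 : ℝ) ^ 7 ≤ Real.exp 1 ^ 7 :=
      pow_le_pow_left₀ (by norm_num) (by linarith [Real.exp_one_gt_d9]) 7
    rw [← Real.exp_nat_mul] at h2
    norm_num at h2 ⊢
    linarith
  calc (c : ℝ) ≤ d₃ * 625 ^ d := by exact_mod_cast h
    _ ≤ d₃ * Real.exp 7 ^ d := by gcongr
    _ = _ := by rw [← Real.exp_nat_mul, mul_comm (d : ℝ)]

/-- If B w ≤ q, the quadratic slack is at most q w. Otherwise `hq` forces q w ≥ 4ν²β², which already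
exceeds the curvature term on the ball. -/
theorem sub_mul_le_of_quadratic_slack {Lam ν β a w Q q B : ℝ}
    (hLam : Lam ≤ 2 * ν ^ 2) (ha0 : 0 ≤ a) (ha : a ≤ β) (hw : 0 ≤ w) (hB : 0 < B) (hq0 : 0 ≤ q)
    (hQ : 0 ≤ Q) (hq : B * (4 * ν ^ 2 * β ^ 2) ≤ q ^ 2)
    (hslack : 2 / 3 * Lam * a ^ 2 - Q ≤ B * w ^ 2) : 2 / 3 * Lam * a ^ 2 - q * w ≤ Q := by
  rcases le_or_gt (B * w) q with h | h
  · have : B * w ^ 2 ≤ q * w := by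
      calc B * w ^ 2 = B * w * w := by ring
        _ ≤ q * w := by gcongr
    linarith
  · have h3 : B * (4 * ν ^ 2 * β ^ 2) ≤ B * (q * w) := by
      refine hq.trans ?_
      calc q ^ 2 = q * q := sq q
        _ ≤ q * (B * w) := by gcongr
        _ = _ := by ring
    have h4 : 4 * ν ^ 2 * β ^ 2 ≤ q * w := le_of_mul_le_mul_left h3 hB
    have h5 : 2 / 3 * Lam * a ^ 2 ≤ 4 * ν ^ 2 * β ^ 2 := by
      calc 2 / 3 * Lam * a ^ 2 ≤ 2 / 3 * (2 * ν ^ 2) * β ^ 2 := by gcongr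
        _ ≤ _ := by nlinarith [mul_nonneg (sq_nonneg ν) (sq_nonneg β)]
    linarith

variable {d d₃ n : ℕ} {Ω : Type*} [MeasurableSpace Ω] {P : Measure Ω} [IsProbabilityMeasure P]
  {X : Fin n → Ω → Tensor d d₃} {y ε : Fin n → Ω → ℝ} {B₀ : Tensor d d₃} {σ : ℝ≥0} {ν : ℝ}
  {N : Finset (Tensor d d₃)}

omit [IsProbabilityMeasure P] in
theorem measurableSet_setOf_exists_mem {α : Type*} (s : Finset α) (S : α → Set Ω)
    (h : ∀ a ∈ s, MeasurableSet (S a)) : MeasurableSet {ω | ∃ a ∈ s, ω ∈ S a} := by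
  have he : {ω | ∃ a ∈ s, ω ∈ S a} = ⋃ a ∈ s, S a := by
    ext ω
    simp
  rw [he]
  exact s.measurableSet_biUnion h

theorem IsLinearTensorSample.measure_exists_noise_gt_le
    (hS : IsLinearTensorSample P X y ε B₀ σ) (hX : ∀ i, IsSubGaussianTensor P (X i) ν)
    (hν : 0 < ν) (hd : 0 < d) (hd₃ : 0 < d₃) (hn : 0 < n) (hcard : N.card ≤ d₃ * 625 ^ d)
    (hN : ∀ a ∈ N, ‖a‖ ^ 2 ≤ d₃) {m A : ℝ} (hm0 : 0 < m) (hm1 : m ≤ 1) (hmn : m ^ 2 * d ≤ n) :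
    P.real {ω | ∃ a ∈ N, ω ∈ {ω | (σ + 1) * ν * (A + 10) / m * √((d : ℝ) * d₃ / n) <
      ⟪(1 / (n : ℝ)) • ∑ i, ε i ω • X i ω, a⟫}} ≤ d₃ * Real.exp (-((A + 2) * d)) := by
  have hd' : (0 : ℝ) < d := by exact_mod_cast hd
  have hd₃' : (0 : ℝ) < d₃ := by exact_mod_cast hd₃
  have hn' : (0 : ℝ) < n := by exact_mod_cast hn
  have hσ : (0 : ℝ) ≤ σ := σ.2
  -- At the threshold the linear term of the Chernoff exponent is (A + 10)d and the moment cost is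
  -- at most m²d ≤ d; of the remaining (A + 9)d, counting the atoms takes 7d. Using σ + 1 admits σ =
  -- 0.
  set s := m * √((d : ℝ) / n) / ((σ + 1) * ν * √(d₃ : ℝ)) with hs
  have hs0 : 0 < s := by positivity
  have hs2 : ν ^ 2 * s ^ 2 * σ ^ 2 * d₃ ≤ m ^ 2 * d / n := by
    have e : ν ^ 2 * s ^ 2 * σ ^ 2 * d₃ = m ^ 2 * d / n * (σ / (σ + 1)) ^ 2 := by
      rw [hs, div_pow, mul_pow, mul_pow, mul_pow, Real.sq_sqrt (by positivity),
        Real.sq_sqrt (by positivity)]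
      field_simp
    rw [e]
    refine mul_le_of_le_one_right (by positivity) (pow_le_one₀ (by positivity) ?_)
    exact div_le_one_of_le₀ (by linarith) (by positivity)
  have hsn : m ^ 2 * d / n ≤ 1 := div_le_one_of_le₀ hmn hn'.le
  have hprod : s * n * ((σ + 1) * ν * (A + 10) / m * √((d : ℝ) * d₃ / n)) = (A + 10) * d := by
    have e : √((d : ℝ) * d₃ / n) = √((d : ℝ) / n) * √(d₃ : ℝ) := by
      rw [← Real.sqrt_mul (by positivity)]
      congr 1
      ring
    have e2 : √((d : ℝ) / n) * √((d : ℝ) / n) = d / n := Real.mul_self_sqrt (by positivity)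
    have e3 : s * n * ((σ + 1) * ν * (A + 10) / m * √((d : ℝ) * d₃ / n)) =
        n * (A + 10) * (√((d : ℝ) / n) * √((d : ℝ) / n)) := by
      rw [e, hs]
      field_simp
    rw [e3, e2]
    field_simp
  have hsingle : ∀ a ∈ N, P.real {ω | (σ + 1) * ν * (A + 10) / m * √((d : ℝ) * d₃ / n) <
      ⟪(1 / (n : ℝ)) • ∑ i, ε i ω • X i ω, a⟫} ≤ Real.exp (-((A + 9) * d)) := by
    intro a ha
    have h1 : ν ^ 2 * s ^ 2 * σ ^ 2 * ‖a‖ ^ 2 ≤ m ^ 2 * d / n :=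
      (mul_le_mul_of_nonneg_left (hN a ha) (by positivity)).trans hs2
    refine (hS.measure_noise_gt_le hX hν a hs0 (h1.trans hsn) _).trans (Real.exp_le_exp.2 ?_)
    rw [hprod]
    have h2 : n * (ν ^ 2 * s ^ 2 * σ ^ 2 * ‖a‖ ^ 2) ≤ n * (m ^ 2 * d / n) := by gcongr
    have h3 : n * (m ^ 2 * d / n) = m ^ 2 * d := by field_simp
    have h4 : m ^ 2 * d ≤ 1 * d := by
      gcongr
      exact pow_le_one₀ hm0.le hm1
    linarith
  refine (measureReal_setOf_exists_mem_le N _ hsingle).trans ?_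
  calc (N.card : ℝ) * Real.exp (-((A + 9) * d)) ≤ d₃ * Real.exp (7 * d) *
        Real.exp (-((A + 9) * d)) := by
        gcongr
        exact natCast_card_le_mul_exp hcard
    _ = _ := by
        rw [mul_assoc, ← Real.exp_add]
        ring_nf

theorem IsLinearTensorSample.measure_exists_empirical_gt_le
    (hS : IsLinearTensorSample P X y ε B₀ σ) (hX : ∀ i, IsSubGaussianTensor P (X i) ν)
    (hν : 0 < ν) (hd₃ : 0 < d₃) (hn : 0 < n) (hcard : N.card ≤ d₃ * 625 ^ d)
    (hN : ∀ a ∈ N, ‖a‖ ^ 2 ≤ d₃) {A : ℝ} (hA : (A + 9) * d ≤ n) :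
    P.real {ω | ∃ a ∈ N, ω ∈ {ω | 4 * ν ^ 2 * d₃ < (1 / (n : ℝ)) * ∑ i, ⟪X i ω, a⟫ ^ 2}} ≤
      d₃ * Real.exp (-((A + 2) * d)) := by
  have hd₃' : (0 : ℝ) < d₃ := by exact_mod_cast hd₃
  refine (measureReal_setOf_exists_mem_le N _ fun a ha =>
    hS.measure_empirical_gt_le hX hν hn a hd₃' (hN a ha)).trans ?_
  calc (N.card : ℝ) * Real.exp (-n) ≤ d₃ * Real.exp (7 * d) * Real.exp (-((A + 9) * d)) := by
        gcongr
        exact natCast_card_le_mul_exp hcard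
    _ = _ := by
        rw [mul_assoc, ← Real.exp_add]
        ring_nf

/-- Half of the lower-tail exponent pays for the |N|^s sums, the other half gives the probability.
The hypothesis `hA` makes log |N| at most (A + 7)d. -/
theorem IsLinearTensorSample.measure_exists_empirical_lt_le
    (hS : IsLinearTensorSample P X y ε B₀ σ) (hX : ∀ i, IsSubGaussianTensor P (X i) ν)
    (hν : 0 < ν) (hd₃ : 0 < d₃) (hn : 0 < n) (hcard : N.card ≤ d₃ * 625 ^ d) {κ A : ℝ}
    (hκ : 0 < κ) (hLam : κ ≤ minEigenvalue (populationHessian P X)) {s : ℕ}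
    (hA : (d₃ : ℝ) ≤ Real.exp (A * d))
    (hs : s * ((A + 7) * d) ≤ κ ^ 2 / (144 * ν ^ 4) * n / 2)
    (hAn : (A + 2) * d ≤ κ ^ 2 / (144 * ν ^ 4) * n / 2) :
    P.real {ω | ∃ f ∈ (Finset.univ : Finset (Fin s → N)),
      ω ∈ {ω | (1 / (n : ℝ)) * ∑ i, ⟪X i ω, ∑ k, (f k : Tensor d d₃)⟫ ^ 2 <
        2 / 3 * minEigenvalue (populationHessian P X) * ‖∑ k, (f k : Tensor d d₃)‖ ^ 2}} ≤
      d₃ * Real.exp (-((A + 2) * d)) := by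
  have hd₃' : (1 : ℝ) ≤ d₃ := by exact_mod_cast hd₃
  refine (measureReal_setOf_exists_mem_le Finset.univ _ fun f _ =>
    hS.measure_empirical_lt_le hX hν hn hκ hLam (∑ k, (f k : Tensor d d₃))).trans ?_
  have hc : ((Finset.univ : Finset (Fin s → N)).card : ℝ) ≤ Real.exp (s * ((A + 7) * d)) := by
    rw [Finset.card_univ, Fintype.card_fun, Fintype.card_coe, Fintype.card_fin, Real.exp_nat_mul]
    push_cast
    refine pow_le_pow_left₀ (Nat.cast_nonneg _) ((natCast_card_le_mul_exp hcard).trans ?_) _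
    calc (d₃ : ℝ) * Real.exp (7 * d) ≤ Real.exp (A * d) * Real.exp (7 * d) := by gcongr
      _ = _ := by rw [← Real.exp_add]; ring_nf
  calc _ ≤ Real.exp (s * ((A + 7) * d)) * Real.exp (-(κ ^ 2 / (144 * ν ^ 4) * n)) := by gcongr
    _ = Real.exp (s * ((A + 7) * d) + -(κ ^ 2 / (144 * ν ^ 4) * n)) := by rw [Real.exp_add]
    _ ≤ Real.exp (-((A + 2) * d)) := Real.exp_le_exp.2 (by linarith)
    _ ≤ _ := le_mul_of_one_le_left (Real.exp_pos _).le hd₃'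

theorem IsLinearTensorSample.exists_noiseEvent
    (hS : IsLinearTensorSample P X y ε B₀ σ) (hX : ∀ i, IsSubGaussianTensor P (X i) ν)
    (hν : 0 < ν) (hd : 0 < d) (hd₃ : 0 < d₃) (hn : 0 < n) {A m q : ℝ}
    (hm0 : 0 < m) (hm1 : m ≤ 1) (hmn : m ^ 2 * d ≤ n)
    (hq : 4 * ((σ + 1) * ν * (A + 10) / m * √((d : ℝ) * d₃ / n)) ≤ q) :
    ∃ bad : Set Ω, MeasurableSet bad ∧ P.real bad ≤ d₃ * Real.exp (-((A + 2) * d)) ∧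
      ∀ ω, ω ∉ bad → ∀ Δ : Tensor d d₃,
        ⟪(1 / (n : ℝ)) • ∑ i, ε i ω • X i ω, Δ⟫ ≤ q * Δ.nuclearNorm := by
  obtain ⟨N, hcard, hN1, hN2⟩ := Tensor.exists_finset_inner_le d hd₃
  refine ⟨_, ?_, hS.measure_exists_noise_gt_le hX hν hd hd₃ hn hcard hN1 hm0 hm1 hmn, ?_⟩
  · exact measurableSet_setOf_exists_mem N _ fun a _ =>
      measurableSet_lt measurable_const (measurable_inner_tensor (
          (Finset.measurable_sum _ fun i _ =>
        (hS.measurable_noise i).smul (hS.measurable_X i)).const_smul (1 / (n : ℝ))) a)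
  · intro ω hω Δ
    refine (hN2 _ Δ _ fun a ha => ?_).trans
      (mul_le_mul_of_nonneg_right hq Δ.nuclearNorm_nonneg)
    by_contra h
    exact hω ⟨a, ha, not_le.1 h⟩

/-- In small samples the nuclear norm slack dominates on the ball of radius `β`. -/
theorem two_thirds_mul_sq_le_of_small_sample (hd₃ : 0 < d₃) (hn : 0 < n) {Lam β M q : ℝ}
    (hLam : Lam ≤ 2 * ν ^ 2) (hM0 : 0 < M) (hnM : (n : ℝ) ≤ M * d)
    (hq : 2 * ν ^ 2 * β * √M * √((d : ℝ) * d₃ / n) ≤ q) (x : Fin n → Tensor d d₃)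
    (Δ : Tensor d d₃) (hΔ : ‖Δ‖ ≤ β) :
    2 / 3 * Lam * ‖Δ‖ ^ 2 - q * Δ.nuclearNorm ≤ (1 / (n : ℝ)) * ∑ i, ⟪x i, Δ⟫ ^ 2 := by
  have hd₃' : (0 : ℝ) < d₃ := by exact_mod_cast hd₃
  have hn' : (0 : ℝ) < n := by exact_mod_cast hn
  have hβ : 0 ≤ β := (norm_nonneg Δ).trans hΔ
  set τ := √((d : ℝ) * d₃ / n) with hτ
  have hQ : 0 ≤ (1 / (n : ℝ)) * ∑ i, ⟪x i, Δ⟫ ^ 2 :=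
    mul_nonneg (by positivity) (Finset.sum_nonneg fun _ _ => sq_nonneg _)
  have h1 : √(d₃ : ℝ) ≤ √M * τ := by
    rw [hτ, ← Real.sqrt_mul hM0.le]
    refine Real.sqrt_le_sqrt ?_
    rw [← mul_div_assoc, le_div_iff₀ hn']
    nlinarith
  have h2 := Δ.norm_le_sqrt_mul_nuclearNorm hd₃
  have h3 : 2 / 3 * Lam * ‖Δ‖ ^ 2 ≤ q * Δ.nuclearNorm := by
    calc 2 / 3 * Lam * ‖Δ‖ ^ 2 ≤ 2 * ν ^ 2 * ‖Δ‖ ^ 2 :=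
          mul_le_mul_of_nonneg_right (by nlinarith [sq_nonneg ν]) (sq_nonneg _)
      _ = 2 * ν ^ 2 * ‖Δ‖ * ‖Δ‖ := by ring
      _ ≤ 2 * ν ^ 2 * β * (√M * τ * Δ.nuclearNorm) := by
          have h4 : ‖Δ‖ ≤ √M * τ * Δ.nuclearNorm :=
            h2.trans (mul_le_mul_of_nonneg_right h1 Δ.nuclearNorm_nonneg)
          gcongr
      _ = (2 * ν ^ 2 * β * √M * τ) * Δ.nuclearNorm := by ring
      _ ≤ _ := mul_le_mul_of_nonneg_right hq Δ.nuclearNorm_nonneg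
  linarith

/-- Restricted strong convexity on the ball of radius `β` in large samples. -/
theorem IsLinearTensorSample.exists_rscEvent
    (hS : IsLinearTensorSample P X y ε B₀ σ) (hX : ∀ i, IsSubGaussianTensor P (X i) ν)
    (hν : 0 < ν) (hd : 0 < d) (hd₃ : 0 < d₃) (hn : 0 < n) {κ A β q : ℝ}
    (hκ : 0 < κ) (hLam : κ ≤ minEigenvalue (populationHessian P X)) (hA : 0 < A) (hβ : 0 < β)
    (hA3 : (d₃ : ℝ) ≤ Real.exp (A * d))
    (hnM : (8 * (A + 7) / (κ ^ 2 / (144 * ν ^ 4)) + A + 9) * d < n)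
    (hq : 2 * ν * β * √(256 * ν ^ 2 * (A + 7) / (κ ^ 2 / (144 * ν ^ 4))) *
      √((d : ℝ) * d₃ / n) ≤ q) :
    ∃ bad : Set Ω, MeasurableSet bad ∧ P.real bad ≤ 2 * (d₃ * Real.exp (-((A + 2) * d))) ∧
      ∀ ω, ω ∉ bad → ∀ Δ : Tensor d d₃, ‖Δ‖ ≤ β →
        2 / 3 * minEigenvalue (populationHessian P X) * ‖Δ‖ ^ 2 - q * Δ.nuclearNorm ≤
          (1 / (n : ℝ)) * ∑ i, ⟪X i ω, Δ⟫ ^ 2 := by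
  have hd' : (1 : ℝ) ≤ d := by exact_mod_cast hd
  have hd₃' : (0 : ℝ) < d₃ := by exact_mod_cast hd₃
  have hn' : (0 : ℝ) < n := by exact_mod_cast hn
  obtain ⟨N, hcard, hN1, hN2⟩ := Tensor.exists_finset_inner_le d hd₃
  have hLam2 := minEigenvalue_populationHessian_le hd hd₃ hn hν hS.measurable_X hX
  set Lam := minEigenvalue (populationHessian P X)
  set c := κ ^ 2 / (144 * ν ^ 4) with hc
  have hc0 : 0 < c := by positivity
  set M := 8 * (A + 7) / c + A + 9 with hM
  set τ := √((d : ℝ) * d₃ / n) with hτ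
  have hτ0 : 0 < τ := Real.sqrt_pos.2 (by positivity)
  have hτ2 : τ ^ 2 = (d : ℝ) * d₃ / n := Real.sq_sqrt (by positivity)
  have hmX := hS.measurable_X
  -- The number of atoms, before rounding down, that the union bound can afford. The size of `M`
  -- ensures x ≥ 4, so that s - 1 ≥ x/2 after rounding.
  set x := c * n / (2 * ((A + 7) * d)) with hx
  have hxd : x * ((A + 7) * d) = c * n / 2 := by
    rw [hx]
    field_simp
  have hcn : 8 * ((A + 7) * d) ≤ c * n := by
    have h1 : c * (M * d) ≤ c * n := by gcongr
    have h2 : c * (M * d) = 8 * ((A + 7) * d) + c * (A + 9) * d := by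
      rw [hM]
      field_simp
      ring
    have : 0 ≤ c * (A + 9) * d := by positivity
    linarith
  have hx4 : 4 ≤ x := by
    rw [hx, le_div_iff₀ (by positivity)]
    linarith
  set s := ⌊x⌋₊
  have hsx : (s : ℝ) ≤ x := Nat.floor_le (by linarith)
  have hxs : x < s + 1 := Nat.lt_floor_add_one x
  have hs0 : 0 < s := Nat.floor_pos.2 (by linarith)
  have hs1 : x / 2 ≤ (s : ℝ) - 1 := by linarith
  set bad₂ : Set Ω :=
    {ω | ∃ a ∈ N, ω ∈ {ω | 4 * ν ^ 2 * d₃ < (1 / (n : ℝ)) * ∑ i, ⟪X i ω, a⟫ ^ 2}}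
  set bad₃ : Set Ω := {ω | ∃ f ∈ (Finset.univ : Finset (Fin s → N)),
    ω ∈ {ω | (1 / (n : ℝ)) * ∑ i, ⟪X i ω, ∑ k, (f k : Tensor d d₃)⟫ ^ 2 <
      2 / 3 * Lam * ‖∑ k, (f k : Tensor d d₃)‖ ^ 2}}
  have hb₂ : P.real bad₂ ≤ d₃ * Real.exp (-((A + 2) * d)) := by
    refine hS.measure_exists_empirical_gt_le hX hν hd₃ hn hcard hN1 (le_trans ?_ hnM.le)
    refine mul_le_mul_of_nonneg_right ?_ (by linarith)
    rw [hM]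
    have : 0 ≤ 8 * (A + 7) / c := by positivity
    linarith
  have hb₃ : P.real bad₃ ≤ d₃ * Real.exp (-((A + 2) * d)) := by
    refine hS.measure_exists_empirical_lt_le hX hν hd₃ hn hcard hκ hLam hA3 ?_ ?_
    · rw [← hc, ← hxd]
      gcongr
    · rw [← hc]
      nlinarith
  have hsum : ∀ a : Tensor d d₃, Measurable fun ω => (1 / (n : ℝ)) * ∑ i, ⟪X i ω, a⟫ ^ 2 :=
    fun a => (Finset.measurable_sum _ fun i _ =>
      (measurable_inner_tensor (hmX i) a).pow_const 2).const_mul _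
  have hbm₂ : MeasurableSet bad₂ := measurableSet_setOf_exists_mem N _ fun a _ =>
    measurableSet_lt measurable_const (hsum a)
  have hbm₃ : MeasurableSet bad₃ := measurableSet_setOf_exists_mem _ _ fun f _ =>
    measurableSet_lt (hsum _) measurable_const
  have hbm := hbm₂.union hbm₃
  refine ⟨bad₂ ∪ bad₃, hbm, ?_, fun ω hω Δ hΔ => ?_⟩
  · have h1 := measureReal_union_le (μ := P) bad₂ bad₃
    linarith
  · simp only [Set.mem_union, not_or] at hω
    obtain ⟨hω₂, hω₃⟩ := hω
    have hQ : 0 ≤ (1 / (n : ℝ)) * ∑ i, ⟪X i ω, Δ⟫ ^ 2 :=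
      mul_nonneg (by positivity) (Finset.sum_nonneg fun _ _ => sq_nonneg _)
    have hLam0 : 0 < Lam := hκ.trans_le hLam
    have hkey := le_empirical_of_sum_atoms hd₃ hN2 (fun i => X i ω)
      (c := 2 / 3 * Lam) (K := 4 * ν ^ 2 * d₃) (by positivity) hs0
      (fun a ha => by
        by_contra h
        exact hω₂ ⟨a, ha, not_le.1 h⟩)
      (fun f => by
        by_contra h
        exact hω₃ ⟨f, Finset.mem_univ _, not_le.1 h⟩) Δ
    have hT0 : 0 < 256 * ν ^ 2 * (A + 7) / c := by positivity
    refine sub_mul_le_of_quadratic_slack (B := 256 * ν ^ 2 * (A + 7) / c * τ ^ 2) hLam2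
      (norm_nonneg _) hΔ Δ.nuclearNorm_nonneg (by positivity) (le_trans (by positivity) hq) hQ
      ?_ ?_
    · have h1 := pow_le_pow_left₀ (by positivity) hq 2
      rw [mul_pow, mul_pow, Real.sq_sqrt hT0.le] at h1
      linarith
    · rcases le_or_gt (2 / 3 * Lam * ‖Δ‖ ^ 2 - (1 / (n : ℝ)) * ∑ i, ⟪X i ω, Δ⟫ ^ 2) 0 with h | h
      · exact h.trans (by positivity)
      · have h1 := (mul_le_mul_of_nonneg_right hs1 h.le).trans hkey
        have h2 : 16 * (4 * ν ^ 2 * d₃) * Δ.nuclearNorm ^ 2 =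
            x / 2 * (256 * ν ^ 2 * (A + 7) / c * τ ^ 2 * Δ.nuclearNorm ^ 2) := by
          rw [hτ2, hx]
          field_simp
          ring
        rw [h2] at h1
        exact le_of_mul_le_mul_left h1 (by linarith)

/-- Simultaneous control of the noise and restricted strong convexity on the ball of radius `β`. -/
theorem IsLinearTensorSample.exists_goodEvent
    (hS : IsLinearTensorSample P X y ε B₀ σ) (hX : ∀ i, IsSubGaussianTensor P (X i) ν)
    (hν : 0 < ν) (hd : 0 < d) (hd₃ : 0 < d₃) (hn : 0 < n) {κ A β m q : ℝ}
    (hκ : 0 < κ) (hLam : κ ≤ minEigenvalue (populationHessian P X)) (hA : 0 < A) (hβ : 0 < β)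
    (hm0 : 0 < m) (hm1 : m ≤ 1) (hmn : m ^ 2 * d ≤ n)
    (hq1 : 4 * ((σ + 1) * ν * (A + 10) / m * √((d : ℝ) * d₃ / n)) ≤ q)
    (hq2 : 2 * ν ^ 2 * β * √(8 * (A + 7) / (κ ^ 2 / (144 * ν ^ 4)) + A + 9) *
      √((d : ℝ) * d₃ / n) ≤ q)
    (hq3 : 2 * ν * β * √(256 * ν ^ 2 * (A + 7) / (κ ^ 2 / (144 * ν ^ 4))) *
      √((d : ℝ) * d₃ / n) ≤ q) :
    ∃ G : Set Ω, MeasurableSet G ∧ 1 - (d₃ : ℝ) * Real.exp (-(A * d)) ≤ P.real G ∧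
      ∀ ω ∈ G, ∀ Δ : Tensor d d₃, ‖Δ‖ ≤ β →
        ⟪(1 / (n : ℝ)) • ∑ i, ε i ω • X i ω, Δ⟫ ≤ q * Δ.nuclearNorm ∧
        2 / 3 * minEigenvalue (populationHessian P X) * ‖Δ‖ ^ 2 - q * Δ.nuclearNorm ≤
          (1 / (n : ℝ)) * ∑ i, ⟪X i ω, Δ⟫ ^ 2 := by
  have hd' : (1 : ℝ) ≤ d := by exact_mod_cast hd
  -- Here the probability claim is void and the empty event will do; otherwise d₃ ≤ e^(Ad), which
  -- removes log d₃ from the union bound over sums.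
  by_cases hA3 : 1 ≤ (d₃ : ℝ) * Real.exp (-(A * d))
  · exact ⟨∅, MeasurableSet.empty, by simpa using hA3, by simp⟩
  have hA3' : (d₃ : ℝ) ≤ Real.exp (A * d) := by
    rw [not_le, Real.exp_neg, ← div_eq_mul_inv, div_lt_one (Real.exp_pos _)] at hA3
    exact hA3.le
  -- The spare 2 in A + 2 absorbs the three bad events: 3 ≤ e^(2d).
  have hexp : 3 * (d₃ * Real.exp (-((A + 2) * d))) ≤ d₃ * Real.exp (-(A * d)) := by
    have e : Real.exp (-(A * d)) = Real.exp (2 * d) * Real.exp (-((A + 2) * d)) := by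
      rw [← Real.exp_add]
      ring_nf
    have h3 : (3 : ℝ) ≤ Real.exp (2 * d) := by
      have := Real.add_one_le_exp (2 * (d : ℝ))
      linarith
    rw [e]
    have : 0 ≤ d₃ * Real.exp (-((A + 2) * d)) := by positivity
    nlinarith
  have hpos : 0 ≤ d₃ * Real.exp (-((A + 2) * d)) := by positivity
  obtain ⟨bad₁, hbm₁, hb₁, hnoise⟩ := hS.exists_noiseEvent hX hν hd hd₃ hn hm0 hm1 hmn hq1
  rcases le_or_gt (n : ℝ) ((8 * (A + 7) / (κ ^ 2 / (144 * ν ^ 4)) + A + 9) * d) with hnM | hnM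
  · refine ⟨bad₁ᶜ, hbm₁.compl, ?_, fun ω hω Δ hΔ => ⟨hnoise ω hω Δ, ?_⟩⟩
    · rw [probReal_compl_eq_one_sub hbm₁]
      linarith
    · exact two_thirds_mul_sq_le_of_small_sample hd₃ hn
        (minEigenvalue_populationHessian_le hd hd₃ hn hν hS.measurable_X hX) (by positivity) hnM hq2
        (fun i => X i ω) Δ hΔ
  · obtain ⟨bad₂, hbm₂, hb₂, hrsc⟩ := hS.exists_rscEvent hX hν hd hd₃ hn hκ hLam hA hβ hA3' hnM hq3
    refine ⟨(bad₁ ∪ bad₂)ᶜ, (hbm₁.union hbm₂).compl, ?_, fun ω hω Δ hΔ => ?_⟩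
    · rw [probReal_compl_eq_one_sub (hbm₁.union hbm₂)]
      have := measureReal_union_le (μ := P) bad₁ bad₂
      linarith
    · simp only [Set.mem_compl_iff, Set.mem_union, not_or] at hω
      exact ⟨hnoise ω hω.1 Δ, hrsc ω hω.2 Δ hΔ⟩

end GoodEvents

/-! ### Choice of constants and conclusion -/

theorem mainTheorem7 :
    ∃ C : ℝ, 0 < C ∧ ∃ c : ℝ, 0 < c ∧
    ∀ (ν κ Cρ : ℝ) (σ : ℝ≥0), 0 < ν → 0 < κ → 0 < Cρ →
    ∃ C₁ : ℝ, 0 < C₁ ∧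
    ∀ β A : ℝ, 0 < β → 0 < A →
    ∃ c₀ : ℝ, 0 < c₀ ∧
    ∀ (d d₃ n r : ℕ), 0 < d → 0 < d₃ → 0 < n → 0 < r →
    ∀ (B₀ : Tensor d d₃), B₀.tubalRank = r →
    ∀ (Ω : Type*) [MeasurableSpace Ω] (P : Measure Ω) [IsProbabilityMeasure P]
      (X : Fin n → Ω → Tensor d d₃) (y ε : Fin n → Ω → ℝ),
      IsLinearTensorSample P X y ε B₀ σ →
      (∀ i, IsSubGaussianTensor P (X i) ν) →
      κ ≤ minEigenvalue (populationHessian P X) →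
    ∀ (lam μ : ℝ) (ρ : ℝ → ℝ), IsPenalty ρ lam μ Cρ →
      3 * μ < 2 * minEigenvalue (populationHessian P X) →
      c₀ * √((d : ℝ) * d₃ / n) ≤ lam →
      C₁ * r * d * d₃ / β ^ 2 ≤ (n : ℝ) →
    ∃ E : Set Ω, MeasurableSet E ∧ 1 - (d₃ : ℝ) * Real.exp (-(A * d)) ≤ P.real E ∧
      ∀ ω ∈ E, ∀ B : Tensor d d₃,
        IsStationaryPoint (objective (fun i => X i ω) (fun i => y i ω) ρ) B →
        ‖B - B₀‖ ≤ β →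
          ‖B - B₀‖ ≤
            C * (Cρ * lam * √(r : ℝ)) / (2 * minEigenvalue (populationHessian P X) - 3 * μ) ∧
          (B - B₀).nuclearNorm ≤
            C * (Cρ * lam * r) / (2 * minEigenvalue (populationHessian P X) - 3 * μ) ∧
          (1 / (n : ℝ)) * ∑ i, (⟪X i ω, B - B₀⟫) ^ 2 ≤
            Cρ ^ 2 * lam ^ 2 * r *
              (c / (2 * minEigenvalue (populationHessian P X) - 3 * μ) +
                c * μ / (2 * minEigenvalue (populationHessian P X) - 3 * μ) ^ 2) := by
  refine ⟨54, by norm_num, 81, by norm_num, fun ν κ Cρ σ hν hκ hCρ => ⟨1, one_pos, ?_⟩⟩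
  intro β A hβ hA
  -- The sample size condition serves only to give m²d ≤ n, which keeps the noise Chernoff parameter
  -- in its admissible range; hence `C₁ = 1`.
  set m : ℝ := min 1 (1 / β) with hm
  have hm0 : 0 < m := lt_min one_pos (by positivity)
  have hm1 : m ≤ 1 := min_le_left _ _
  have hmβ : m ≤ 1 / β := min_le_right _ _
  have hσ : (0 : ℝ) ≤ σ := σ.2
  set k₁ : ℝ := 4 * ((σ + 1) * ν * (A + 10) / m) with hk₁
  set k₂ : ℝ := 2 * ν ^ 2 * β * √(8 * (A + 7) / (κ ^ 2 / (144 * ν ^ 4)) + A + 9) with hk₂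
  set k₃ : ℝ := 2 * ν * β * √(256 * ν ^ 2 * (A + 7) / (κ ^ 2 / (144 * ν ^ 4))) with hk₃
  have hk₁0 : 0 < k₁ := by positivity
  have hk₂0 : 0 ≤ k₂ := by positivity
  have hk₃0 : 0 ≤ k₃ := by positivity
  -- Makes λ C_ρ'/4 at least each of the three slack levels: noise, small samples, and the Maurey
  -- loss.
  refine ⟨4 / Cρ * (k₁ + k₂ + k₃), by positivity, ?_⟩
  intro d d₃ n r hd hd₃ hn hr B₀ hB₀ Ω _ P _ X y ε hS hX hLam lam μ ρ hρ hD hlam hnr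
  have hd' : (0 : ℝ) < d := by exact_mod_cast hd
  have hd₃' : (1 : ℝ) ≤ d₃ := by exact_mod_cast hd₃
  have hn' : (0 : ℝ) < n := by exact_mod_cast hn
  have hr' : (1 : ℝ) ≤ r := by exact_mod_cast hr
  set τ := √((d : ℝ) * d₃ / n) with hτ
  have hτ0 : 0 < τ := Real.sqrt_pos.2 (by positivity)
  have hq : (k₁ + k₂ + k₃) * τ ≤ lam * Cρ / 4 := by
    have h := mul_le_mul_of_nonneg_right hlam (by positivity : 0 ≤ Cρ / 4)
    calc (k₁ + k₂ + k₃) * τ = 4 / Cρ * (k₁ + k₂ + k₃) * τ * (Cρ / 4) := by field_simp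
      _ ≤ _ := h
      _ = _ := by ring
  have h1 : 0 ≤ k₁ * τ := by positivity
  have h2 : 0 ≤ k₂ * τ := by positivity
  have h3 : 0 ≤ k₃ * τ := by positivity
  have hmn : m ^ 2 * d ≤ n := by
    refine le_trans ?_ hnr
    calc m ^ 2 * d ≤ (1 / β) ^ 2 * d := by gcongr
      _ = 1 * 1 * d * 1 / β ^ 2 := by ring
      _ ≤ 1 * r * d * d₃ / β ^ 2 := by gcongr
  have hL : 0 < lam * Cρ := by
    have : 0 < (k₁ + k₂ + k₃) * τ := by positivity
    linarith
  obtain ⟨G, hGm, hGP, hG⟩ := hS.exists_goodEvent hX hν hd hd₃ hn (q := lam * Cρ / 4) hκ hLam hA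
    hβ hm0 hm1 hmn (by rw [← hτ, ← mul_assoc, ← hk₁]; linarith) (by rw [← hτ, ← hk₂]; linarith)
    (by rw [← hτ, ← hk₃]; linarith)
  refine ⟨G, hGm, hGP, fun ω hω B hB hBβ => ?_⟩
  obtain ⟨hnoise, hrsc⟩ := hG ω hω (B - B₀) hBβ
  have h := hB.error_bounds hd₃ hρ hL (fun i => hS.response i ω) hD hnoise hrsc
  rwa [hB₀] at h
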